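/- Let $(M^2,g)$ and $(N^n,h)$ be smooth Riemannian manifolds without boundary, $\dim M=2$, and let $\varphi:M^2\to N^n$ be a smooth Riemannian (isometric) immersion. Let $\nabla$ denote the Levi-Civita connection of $M$ as well as the connection induced by the Levi-Civita connection of $N$ on $\varphi^{-1}(TN)$. Let $B$ be the second fundamental form of $\varphi$, $H=\frac12\operatorname{trace}B$ the mean curvature vector field, $A_H$ the shape operator in the direction $H$, i.e. $\langle A_H X,Y\rangle=\langle B(X,Y),H\rangle$, and $\tau(\varphi)=\operatorname{trace}\nabla d\varphi$ the tension field. The stress-bienergy tensor $S_2$ is the symmetric tensor field of type $(1,1)$ given by $$\langle S_2(X),Y\rangle=\tfrac12|\tau(\varphi)|^2\langle X,Y\rangle+\langle d\varphi,\nabla\tau(\varphi)\rangle\langle X,Y\rangle-\langle d\varphi(X),\nabla_Y\tau(\varphi)\rangle-\langle d\varphi(Y),\nabla_X\tau(\varphi)\rangle ,$$ where $\langle d\varphi,\nabla\tau(\varphi)\rangle=\sum_i\langle d\varphi(e_i),\nabla_{e_i}\tau(\varphi)\rangle$ for an orthonormal basis $(e_i)$ of the tangent space, and $\varphi$ is called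 biconservative if $\operatorname{Div}S_2=\operatorname{trace}\nabla S_2=0$ on $M$. Let $\lambda_1\ge\lambda_2$ be the principal curvatures of $M$, that is, the eigenvalue functions of $A_H$ (counted with multiplicity). If $\varphi$ is biconservative and $\lambda_1$ and $\lambda_2$ are constant functions on $M$, then $\nabla A_H=0$ on $M$. -/

import Mathlib

open Bundle Manifold Module
open scoped ContDiff

noncomputable section

namespace Riem

section Intrinsic

variable {E : Type*} [NormedAddCommGroup E] [NormedSpace ℝ E] [FiniteDimensional ℝ E]
  {G : Type*} [TopologicalSpace G] {I : ModelWithCorners ℝ E G}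
  {M : Type*} [TopologicalSpace M] [ChartedSpace G M] [IsManifold I ∞ M]
  [RiemannianBundle (fun x : M ↦ TangentSpace I x)]

instance tangentFiniteDimensional (x : M) : FiniteDimensional ℝ (TangentSpace I x) :=
  inferInstanceAs (FiniteDimensional ℝ E)

/-- An orthonormal basis of the tangent space at `x`. Every trace below is taken in it (none of
them depends on the choice). -/
def onb (x : M) : OrthonormalBasis (Fin (finrank ℝ (TangentSpace I x))) ℝ (TangentSpace I x) :=
  stdOrthonormalBasis ℝ (TangentSpace I x)

/-- The right-hand side of the Koszul formula,
`X⟨Y,Z⟩ + Y⟨Z,X⟩ - Z⟨X,Y⟩ + ⟨[X,Y],Z⟩ - ⟨[Y,Z],X⟩ + ⟨[Z,X],Y⟩`, at the point `x`. -/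
def koszul (X Y Z : Π x : M, TangentSpace I x) (x : M) : ℝ :=
  mvfderiv I (fun y ↦ inner ℝ (Y y) (Z y)) x (X x)
    + mvfderiv I (fun y ↦ inner ℝ (Z y) (X y)) x (Y x)
    - mvfderiv I (fun y ↦ inner ℝ (X y) (Y y)) x (Z x)
    + inner ℝ (VectorField.mlieBracket I X Y x) (Z x)
    - inner ℝ (VectorField.mlieBracket I Y Z x) (X x)
    + inner ℝ (VectorField.mlieBracket I Z X x) (Y x)

/-- The Levi-Civita connection: `leviCivita Y x v = ∇_v Y` is the tangent vector at `x` with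
`2 ⟨∇_v Y, z⟩ = koszul V Y Z x`, for local extensions `V`, `Z` of `v`, `z` (the Koszul expression
is tensorial in `V` and `Z`). -/
def leviCivita (Y : Π x : M, TangentSpace I x) (x : M) (v : TangentSpace I x) :
    TangentSpace I x :=
  ∑ k, (koszul (FiberBundle.extend E v) Y (FiberBundle.extend E (onb x k)) x / 2) • onb x k

/-- The covariant derivative `(∇_v T)(w) = ∇_v (T W) - T (∇_v W)` of a tensor field `T` of
type (1,1), where `W` is a local extension of `w` (the value does not depend on it). -/
def covDerivEnd (T : Π x : M, TangentSpace I x →ₗ[ℝ] TangentSpace I x) (x : M)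
    (v w : TangentSpace I x) : TangentSpace I x :=
  leviCivita (fun y ↦ T y (FiberBundle.extend E w y)) x v
    - T x (leviCivita (FiberBundle.extend E w) x v)

/-- `∇T = 0`. -/
def IsParallel (T : Π x : M, TangentSpace I x →ₗ[ℝ] TangentSpace I x) : Prop :=
  ∀ (x : M) (v w : TangentSpace I x), covDerivEnd T x v w = 0

/-- The divergence `Div T = trace ∇T = ∑ᵢ (∇_{eᵢ} T)(eᵢ)` of a tensor field of type (1,1). -/
def divergence (T : Π x : M, TangentSpace I x →ₗ[ℝ] TangentSpace I x) (x : M) :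
    TangentSpace I x :=
  ∑ i, covDerivEnd T x (onb x i) (onb x i)

/-- The endomorphism `T` of the tangent space at `x` with `⟨T v, w⟩ = β v w`, for a bilinear
form `β`. -/
def endOfForm (x : M) (β : TangentSpace I x → TangentSpace I x → ℝ) :
    TangentSpace I x →ₗ[ℝ] TangentSpace I x :=
  (onb x).toBasis.constr ℝ fun i ↦ ∑ j, β (onb x i) (onb x j) • onb x j

end Intrinsic

section Maps

variable {E : Type*} [NormedAddCommGroup E] [NormedSpace ℝ E] [FiniteDimensional ℝ E]
  {G : Type*} [TopologicalSpace G] (I : ModelWithCorners ℝ E G)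
  {M : Type*} [TopologicalSpace M] [ChartedSpace G M] [IsManifold I ∞ M]
  [RiemannianBundle (fun x : M ↦ TangentSpace I x)]
  {E' : Type*} [NormedAddCommGroup E'] [NormedSpace ℝ E'] [FiniteDimensional ℝ E']
  {G' : Type*} [TopologicalSpace G'] (J : ModelWithCorners ℝ E' G')
  {N : Type*} [TopologicalSpace N] [ChartedSpace G' N] [IsManifold J ∞ N]
  [RiemannianBundle (fun y : N ↦ TangentSpace J y)]
  (φ : M → N)

/-- A Riemannian immersion: a smooth map whose differential preserves the metrics (and so is
injective at every point). -/
structure IsRiemannianImmersion : Prop where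
  contMDiff : ContMDiff I J ∞ φ
  inner_mfderiv : ∀ (x : M) (v w : TangentSpace I x),
    inner ℝ (mfderiv I J φ x v) (mfderiv I J φ x w) = inner ℝ v w

/-- The connection of the pull-back bundle `φ⁻¹(TN)`: the derivative `∇_v V` of a section `V` along
`φ`. In the frame `(E_a)` of `TN` around `φ x` given by a trivialization, `V = ∑ V^a (E_a ∘ φ)`,
and `∇_v V = ∑ (dV^a(v) E_a + V^a(x) ∇^N_{dφ v} E_a)`. -/
def covDerivAlong (V : Π x : M, TangentSpace J (φ x)) (x : M) (v : TangentSpace I x) :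
    TangentSpace J (φ x) :=
  let t := trivializationAt E' (TangentSpace J : N → Type _) (φ x)
  t.symm (φ x) (mvfderiv I (fun y ↦ (t (TotalSpace.mk' E' (φ y) (V y))).2) x v)
    + leviCivita (FiberBundle.extend E' (V x)) (φ x) (mfderiv I J φ x v)

/-- `∇_v (dφ W)`, for a local extension `W` of the tangent vector `w`. -/
def covDerivPush (x : M) (v w : TangentSpace I x) : TangentSpace J (φ x) :=
  covDerivAlong I J φ (fun y ↦ mfderiv I J φ y (FiberBundle.extend E w y)) x v

/-- `(∇dφ)(v, w) = ∇_v (dφ W) - dφ (∇_v W)`, for a local extension `W` of `w`. -/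
def hessian (x : M) (v w : TangentSpace I x) : TangentSpace J (φ x) :=
  covDerivPush I J φ x v w - mfderiv I J φ x (leviCivita (FiberBundle.extend E w) x v)

/-- The tension field `τ(φ) = trace ∇dφ`. -/
def tension (x : M) : TangentSpace J (φ x) :=
  ∑ i, hessian I J φ x (onb x i) (onb x i)

/-- The normal space of `φ` at `x`: the orthogonal complement of `dφ(T_x M)`. -/
def normalSpace (x : M) : Submodule ℝ (TangentSpace J (φ x)) :=
  (LinearMap.range (mfderiv I J φ x : TangentSpace I x →ₗ[ℝ] TangentSpace J (φ x)))ᗮ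

/-- The second fundamental form `B(v, w)`: the normal part of `∇_v (dφ W)`, for a local extension
`W` of `w`. -/
def secondFundamentalForm (x : M) (v w : TangentSpace I x) : TangentSpace J (φ x) :=
  (normalSpace I J φ x).starProjection (covDerivPush I J φ x v w)

/-- The mean curvature vector field `H = (1/m) trace B`, where `m = dim M`. -/
def meanCurvature (x : M) : TangentSpace J (φ x) :=
  (finrank ℝ (TangentSpace I x) : ℝ)⁻¹ •
    ∑ i, secondFundamentalForm I J φ x (onb x i) (onb x i)

/-- The shape operator `A_H` in the direction of the mean curvature vector field:
`⟨A_H v, w⟩ = ⟨B(v, w), H⟩`. -/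
def shapeOperator (x : M) : TangentSpace I x →ₗ[ℝ] TangentSpace I x :=
  endOfForm x fun v w ↦ inner ℝ (secondFundamentalForm I J φ x v w) (meanCurvature I J φ x)

/-- The stress-bienergy tensor `S₂` of `φ`:
`⟨S₂ v, w⟩ = ½ |τ|² ⟨v, w⟩ + ⟨dφ, ∇τ⟩ ⟨v, w⟩ - ⟨dφ v, ∇_w τ⟩ - ⟨dφ w, ∇_v τ⟩`. -/
def stressBienergy (x : M) : TangentSpace I x →ₗ[ℝ] TangentSpace I x :=
  endOfForm x fun v w ↦
    1 / 2 * ‖tension I J φ x‖ ^ 2 * inner ℝ v w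
      + (∑ i, inner ℝ (mfderiv I J φ x (onb x i))
          (covDerivAlong I J φ (tension I J φ) x (onb x i))) * inner ℝ v w
      - inner ℝ (mfderiv I J φ x v) (covDerivAlong I J φ (tension I J φ) x w)
      - inner ℝ (mfderiv I J φ x w) (covDerivAlong I J φ (tension I J φ) x v)

/-- `φ` is biconservative: `Div S₂ = 0`. -/
def IsBiconservative : Prop :=
  ∀ x : M, divergence (stressBienergy I J φ) x = 0

/-- `lam 0 ≥ lam 1 ≥ ⋯` are the principal curvatures of `φ`: at every point, they are the
eigenvalues of `A_H`, counted with multiplicity. -/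
def IsPrincipalCurvatures {m : ℕ} (lam : Fin m → M → ℝ) : Prop :=
  ∀ x : M, (Antitone fun i ↦ lam i x) ∧
    (shapeOperator I J φ x).charpoly =
      ∏ i, (Polynomial.X - Polynomial.C (lam i x))

end Maps

end Riem

end

set_option linter.unusedSectionVars false

namespace Riem

/-! Write m = dim M. Differentiating ⟨dφ W, dφ Z⟩ = ⟨W, Z⟩ shows that ∇dφ(v, ·) is skew after
pairing with dφ. Since ∇dφ is also symmetric, it is normal (`inner_hessian_mfderiv`). Hence B = ∇dφ
and mH = τ. As τ is normal, differentiating ⟨dφ V, τ⟩ = 0 gives ⟨dφ v, ∇_w τ⟩ = -⟨B(w, v), τ⟩ =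
-m⟨A_H v, w⟩. Substitution into the stress-bienergy tensor yields S₂ = -½|τ|² Id + 2m A_H
(`stressBienergy_eq`).

Since trace A_H = |τ|²/m, constant principal curvatures make |τ|² constant, and biconservativity
reduces to Div A_H = 0 (`divergence_shapeOperator_eq_zero`).

The rest concerns a divergence free symmetric field T on a surface with constant eigenvalues
(`isParallel_of_divergence_eq_zero`). If they coincide, T is a constant multiple of Id. Otherwise ∇T
is off-diagonal in an eigenbasis e₀, e₁ (`inner_covDerivEnd_self`). Pairing (∇_{e₀}T)e₀ +
(∇_{e₁}T)e₁ = 0 with e₁ and with e₀ then kills both off-diagonal components. Neither the Codazzi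
equation nor the curvature of N enters, and no differentiable eigenframe is needed: T² = tT - d,
with t and d constant, is differentiated instead.

Much of the remaining work shows that the pointwise definitions give genuine connections, and that
A_H is differentiable. -/

theorem mvfderiv_congr {E : Type*} [NormedAddCommGroup E] [NormedSpace ℝ E]
    {G : Type*} [TopologicalSpace G] {I : ModelWithCorners ℝ E G}
    {M : Type*} [TopologicalSpace M] [ChartedSpace G M] {x : M} {F : Type*} [NormedAddCommGroup F]
        [NormedSpace ℝ F] {f g : M → F}
    (h : f =ᶠ[nhds x] g) : mvfderiv I f x = mvfderiv I g x := by
  ext v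
  change mfderiv I 𝓘(ℝ, F) f x v = mfderiv I 𝓘(ℝ, F) g x v
  rw [h.mfderiv_eq]
  rfl

/-! ### The Levi-Civita connection from the Koszul formula. -/

section Intrinsic

variable {E : Type*} [NormedAddCommGroup E] [NormedSpace ℝ E] [FiniteDimensional ℝ E]
  {G : Type*} [TopologicalSpace G] {I : ModelWithCorners ℝ E G}
  {M : Type*} [TopologicalSpace M] [ChartedSpace G M] [IsManifold I ∞ M]
  [RiemannianBundle (fun x : M ↦ TangentSpace I x)]
  [IsContMDiffRiemannianBundle I ∞ E (fun x : M ↦ TangentSpace I x)]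

variable {X X' Y Y' Z Z' : Π x : M, TangentSpace I x} {f : M → ℝ} {x : M}

theorem mdifferentiableAt_inner (hX : MDiffAt (T% X) x) (hY : MDiffAt (T% Y) x) :
    MDiffAt (fun y ↦ inner ℝ (X y) (Y y)) x :=
  MDifferentiableAt.inner_bundle (E := fun x : M ↦ TangentSpace I x) hX hY

/-- The two derivatives of `f` coming from the inner products cancel against those coming from the
brackets. Thus the choice of extension of `v` in `leviCivita` does not matter. -/
theorem tensorialAt_koszul_left (hY : MDiffAt (T% Y) x) (hZ : MDiffAt (T% Z) x) :
    TensorialAt I E (fun X ↦ koszul X Y Z x) x where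
  smul {f X} hf hX := by
    have h1 : MDiffAt (fun y ↦ inner ℝ (X y) (Y y)) x := mdifferentiableAt_inner hX hY
    have h2 : MDiffAt (fun y ↦ inner ℝ (Z y) (X y)) x := mdifferentiableAt_inner hZ hX
    have e1 : (fun y ↦ inner ℝ ((f • X) y) (Y y)) = f * fun y ↦ inner ℝ (X y) (Y y) := by
      ext y; simp [inner_smul_left]
    have e2 : (fun y ↦ inner ℝ (Z y) ((f • X) y)) = f * fun y ↦ inner ℝ (Z y) (X y) := by
      ext y; simp [inner_smul_right]
    simp only [koszul, e1, e2, mvfderiv_mul hf h1, mvfderiv_mul hf h2,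
      VectorField.mlieBracket_smul_left hf hX, VectorField.mlieBracket_smul_right hf hX]
    simp [inner_add_left, inner_smul_left, inner_smul_right, real_inner_comm]
    ring
  add {X X'} hX hX' := by
    have h1 : MDiffAt (fun y ↦ inner ℝ (X y) (Y y)) x := mdifferentiableAt_inner hX hY
    have h2 : MDiffAt (fun y ↦ inner ℝ (Z y) (X y)) x := mdifferentiableAt_inner hZ hX
    have h1' : MDiffAt (fun y ↦ inner ℝ (X' y) (Y y)) x := mdifferentiableAt_inner hX' hY
    have h2' : MDiffAt (fun y ↦ inner ℝ (Z y) (X' y)) x := mdifferentiableAt_inner hZ hX'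
    have e1 : (fun y ↦ inner ℝ ((X + X') y) (Y y)) =
        (fun y ↦ inner ℝ (X y) (Y y)) + fun y ↦ inner ℝ (X' y) (Y y) := by
      ext y; simp [inner_add_left]
    have e2 : (fun y ↦ inner ℝ (Z y) ((X + X') y)) =
        (fun y ↦ inner ℝ (Z y) (X y)) + fun y ↦ inner ℝ (Z y) (X' y) := by
      ext y; simp [inner_add_right]
    simp only [koszul, e1, e2, mvfderiv_add h1 h1', mvfderiv_add h2 h2',
      VectorField.mlieBracket_add_left hX hX', VectorField.mlieBracket_add_right hX hX']
    simp [inner_add_left, inner_add_right]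
    ring

/-- The source of metric compatibility: the bracket terms cancel in the symmetrization. -/
theorem koszul_swap_right (X Y Z : Π x : M, TangentSpace I x) (x : M) :
    koszul X Y Z x + koszul X Z Y x =
      2 * mvfderiv I (fun y ↦ inner ℝ (Y y) (Z y)) x (X x) := by
  have h : ∀ X Y : Π x : M, TangentSpace I x,
      (fun y ↦ inner ℝ (X y) (Y y)) = fun y ↦ inner ℝ (Y y) (X y) :=
    fun X Y ↦ funext fun y ↦ real_inner_comm _ _
  simp only [koszul]
  rw [h Z Y, h Z X, h X Y, VectorField.mlieBracket_swap_apply (V := Z) (W := Y),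
    VectorField.mlieBracket_swap_apply (V := X) (W := Z),
    VectorField.mlieBracket_swap_apply (V := Y) (W := X)]
  simp only [inner_neg_left]
  ring

/-- The source of torsion-freeness: here the derivative terms cancel. -/
theorem koszul_swap_left (X Y Z : Π x : M, TangentSpace I x) (x : M) :
    koszul X Y Z x - koszul Y X Z x =
      2 * inner ℝ (VectorField.mlieBracket I X Y x) (Z x) := by
  have h : ∀ X Y : Π x : M, TangentSpace I x,
      (fun y ↦ inner ℝ (X y) (Y y)) = fun y ↦ inner ℝ (Y y) (X y) :=
    fun X Y ↦ funext fun y ↦ real_inner_comm _ _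
  simp only [koszul]
  rw [h X Z, h Z Y, h Y X, VectorField.mlieBracket_swap_apply (V := X) (W := Z),
    VectorField.mlieBracket_swap_apply (V := Z) (W := Y),
    VectorField.mlieBracket_swap_apply (V := Y) (W := X)]
  simp only [inner_neg_left]
  ring

theorem tensorialAt_koszul_right (hX : MDiffAt (T% X) x) (hY : MDiffAt (T% Y) x) :
    TensorialAt I E (fun Z ↦ koszul X Y Z x) x where
  smul {f Z} hf hZ := by
    have h1 : MDiffAt (fun y ↦ inner ℝ (Y y) (Z y)) x := mdifferentiableAt_inner hY hZ
    have h2 : MDiffAt (fun y ↦ inner ℝ (Z y) (X y)) x := mdifferentiableAt_inner hZ hX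
    have e1 : (fun y ↦ inner ℝ (Y y) ((f • Z) y)) = f * fun y ↦ inner ℝ (Y y) (Z y) := by
      ext y; simp [inner_smul_right]
    have e2 : (fun y ↦ inner ℝ ((f • Z) y) (X y)) = f * fun y ↦ inner ℝ (Z y) (X y) := by
      ext y; simp [inner_smul_left]
    simp only [koszul, e1, e2, mvfderiv_mul hf h1, mvfderiv_mul hf h2,
      VectorField.mlieBracket_smul_left hf hZ, VectorField.mlieBracket_smul_right hf hZ]
    simp [inner_add_left, inner_smul_left, inner_smul_right, real_inner_comm]
    ring
  add {Z Z'} hZ hZ' := by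
    have h1 : MDiffAt (fun y ↦ inner ℝ (Y y) (Z y)) x := mdifferentiableAt_inner hY hZ
    have h2 : MDiffAt (fun y ↦ inner ℝ (Z y) (X y)) x := mdifferentiableAt_inner hZ hX
    have h1' : MDiffAt (fun y ↦ inner ℝ (Y y) (Z' y)) x := mdifferentiableAt_inner hY hZ'
    have h2' : MDiffAt (fun y ↦ inner ℝ (Z' y) (X y)) x := mdifferentiableAt_inner hZ' hX
    have e1 : (fun y ↦ inner ℝ (Y y) ((Z + Z') y)) =
        (fun y ↦ inner ℝ (Y y) (Z y)) + fun y ↦ inner ℝ (Y y) (Z' y) := by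
      ext y; simp [inner_add_right]
    have e2 : (fun y ↦ inner ℝ ((Z + Z') y) (X y)) =
        (fun y ↦ inner ℝ (Z y) (X y)) + fun y ↦ inner ℝ (Z' y) (X y) := by
      ext y; simp [inner_add_left]
    simp only [koszul, e1, e2, mvfderiv_add h1 h1', mvfderiv_add h2 h2',
      VectorField.mlieBracket_add_left hZ hZ', VectorField.mlieBracket_add_right hZ hZ']
    simp [inner_add_left, inner_add_right]
    ring

theorem mdifferentiableAt_extend (v : TangentSpace I x) :
    MDiffAt (T% (FiberBundle.extend E v : Π y : M, TangentSpace I y)) x :=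
  FiberBundle.mdifferentiableAt_extend ..

/-- The defining property of the Levi-Civita connection, for arbitrary differentiable fields. -/
theorem two_mul_inner_leviCivita (hX : MDiffAt (T% X) x) (hY : MDiffAt (T% Y) x)
    (hZ : MDiffAt (T% Z) x) :
    2 * inner ℝ (leviCivita Y x (X x)) (Z x) = koszul X Y Z x := by
  have e : ∀ v : TangentSpace I x, MDiffAt (T% (FiberBundle.extend E v : Π y : M, TangentSpace I y))
      x :=
    mdifferentiableAt_extend
  have hV := e (X x)
  have h1 := tensorialAt_koszul_right hV hY
  -- Tensoriality in the first slot trades the extension of `X x` for `X`; tensoriality in the last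
  -- allows `Z x` to be expanded in `onb x`.
  rw [← (tensorialAt_koszul_left hY hZ).pointwise hV hX (by simp), ← h1.mkHom_apply hZ]
  conv_rhs => rw [← (onb x).sum_repr (Z x)]
  rw [map_sum, leviCivita, sum_inner, Finset.mul_sum]
  refine Finset.sum_congr rfl fun k _ ↦ ?_
  rw [map_smul, h1.mkHom_apply_eq_extend, inner_smul_left, OrthonormalBasis.repr_apply_apply]
  simp
  ring

theorem inner_ext {v w : TangentSpace I x}
    (h : ∀ Z : Π x : M, TangentSpace I x, MDiffAt (T% Z) x → inner ℝ v (Z x) = inner ℝ w (Z x)) :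
    v = w :=
  ext_inner_right ℝ fun z ↦ by
    simpa using h (FiberBundle.extend E z) (mdifferentiableAt_extend z)

/-- The Levi-Civita connection is compatible with the metric. -/
theorem mvfderiv_inner (hY : MDiffAt (T% Y) x) (hZ : MDiffAt (T% Z) x) (v : TangentSpace I x) :
    mvfderiv I (fun y ↦ inner ℝ (Y y) (Z y)) x v =
      inner ℝ (leviCivita Y x v) (Z x) + inner ℝ (Y x) (leviCivita Z x v) := by
  have hV := mdifferentiableAt_extend v
  have h := koszul_swap_right (FiberBundle.extend E v) Y Z x
  rw [← two_mul_inner_leviCivita hV hY hZ, ← two_mul_inner_leviCivita hV hZ hY] at h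
  simp only [FiberBundle.extend_apply_self] at h
  rw [real_inner_comm (leviCivita Z x v)]
  linarith

/-- The Levi-Civita connection is torsion-free. -/
theorem leviCivita_sub_leviCivita (hX : MDiffAt (T% X) x) (hY : MDiffAt (T% Y) x) :
    leviCivita Y x (X x) - leviCivita X x (Y x) = VectorField.mlieBracket I X Y x := by
  refine inner_ext fun Z hZ ↦ ?_
  have h := koszul_swap_left X Y Z x
  rw [← two_mul_inner_leviCivita hX hY hZ, ← two_mul_inner_leviCivita hY hX hZ] at h
  rw [inner_sub_left]
  linarith

theorem leviCivita_add_dir (hY : MDiffAt (T% Y) x) (v w : TangentSpace I x) :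
    leviCivita Y x (v + w) = leviCivita Y x v + leviCivita Y x w := by
  refine inner_ext fun Z hZ ↦ ?_
  have h := (tensorialAt_koszul_left hY hZ).add (mdifferentiableAt_extend v)
    (mdifferentiableAt_extend w)
  simp only [← two_mul_inner_leviCivita (mdifferentiableAt_extend v) hY hZ,
    ← two_mul_inner_leviCivita (mdifferentiableAt_extend w) hY hZ,
    ← two_mul_inner_leviCivita (mdifferentiableAt_add_section (mdifferentiableAt_extend v)
      (mdifferentiableAt_extend w)) hY hZ] at h
  simp only [Pi.add_apply, FiberBundle.extend_apply_self] at h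
  rw [inner_add_left]
  linarith

theorem leviCivita_smul_dir (hY : MDiffAt (T% Y) x) (c : ℝ) (v : TangentSpace I x) :
    leviCivita Y x (c • v) = c • leviCivita Y x v := by
  refine inner_ext fun Z hZ ↦ ?_
  have h := (tensorialAt_koszul_left hY hZ).smul (f := fun _ ↦ c) mdifferentiableAt_const
    (mdifferentiableAt_extend v)
  simp only [← two_mul_inner_leviCivita (mdifferentiableAt_extend v) hY hZ,
    ← two_mul_inner_leviCivita (MDifferentiableAt.smul_section (f := fun _ ↦ c)
      mdifferentiableAt_const (mdifferentiableAt_extend v)) hY hZ] at h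
  simp only [Pi.smul_apply', FiberBundle.extend_apply_self, smul_eq_mul] at h
  rw [inner_smul_left]
  simp
  linarith

/-- Metric compatibility determines ⟨∇_v Y, W⟩ as v⟨Y, W⟩ - ⟨Y, ∇_v W⟩, so additivity, the Leibniz
rule and locality in `Y` all follow without reopening the Koszul formula. -/
theorem leviCivita_add (hY : MDiffAt (T% Y) x) (hZ : MDiffAt (T% Z) x) (v : TangentSpace I x) :
    leviCivita (Y + Z) x v = leviCivita Y x v + leviCivita Z x v := by
  refine inner_ext fun W hW ↦ ?_
  have hYZ := mdifferentiableAt_add_section hY hZ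
  have h := mvfderiv_inner hYZ hW v
  have h1 := mvfderiv_inner hY hW v
  have h2 := mvfderiv_inner hZ hW v
  have e1 : (fun y ↦ inner ℝ ((Y + Z) y) (W y)) =
      (fun y ↦ inner ℝ (Y y) (W y)) + fun y ↦ inner ℝ (Z y) (W y) := by
    ext y; simp [inner_add_left]
  rw [e1, mvfderiv_add (mdifferentiableAt_inner hY hW) (mdifferentiableAt_inner hZ hW)] at h
  simp only [_root_.add_apply, Pi.add_apply, inner_add_left] at h ⊢
  linarith

theorem leviCivita_smul (hf : MDiffAt f x) (hY : MDiffAt (T% Y) x) (v : TangentSpace I x) :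
    leviCivita (f • Y) x v = f x • leviCivita Y x v + mvfderiv I f x v • Y x := by
  refine inner_ext fun W hW ↦ ?_
  have h := mvfderiv_inner (hf.smul_section hY) hW v
  have h1 := mvfderiv_inner hY hW v
  have e1 : (fun y ↦ inner ℝ ((f • Y) y) (W y)) = f * fun y ↦ inner ℝ (Y y) (W y) := by
    ext y; simp [inner_smul_left]
  rw [e1, mvfderiv_mul hf (mdifferentiableAt_inner hY hW)] at h
  simp [inner_add_left, inner_smul_left] at h ⊢
  linear_combination -h + f x * h1

theorem leviCivita_congr (hY : MDiffAt (T% Y) x) (h : ∀ᶠ y in nhds x, Y y = Y' y)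
    (v : TangentSpace I x) : leviCivita Y x v = leviCivita Y' x v := by
  refine inner_ext fun W hW ↦ ?_
  have hY' : MDiffAt (T% Y') x := hY.congr_of_eventuallyEq (h.mono fun y hy ↦ by simp [hy])
  have h1 := mvfderiv_inner hY hW v
  have h2 := mvfderiv_inner hY' hW v
  have e : mvfderiv I (fun y ↦ inner ℝ (Y y) (W y)) x =
      mvfderiv I (fun y ↦ inner ℝ (Y' y) (W y)) x := by
    have : (fun y ↦ inner ℝ (Y y) (W y)) =ᶠ[nhds x] fun y ↦ inner ℝ (Y' y) (W y) :=
      h.mono fun y hy ↦ by simp [hy]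
    exact mvfderiv_congr this
  rw [e, h2, h.self_of_nhds] at h1
  linarith

end Intrinsic

/-! ### Smooth orthonormal frames and regularity of the connection. -/

section Smoothness

variable {E : Type*} [NormedAddCommGroup E] [NormedSpace ℝ E] [FiniteDimensional ℝ E]
  {G : Type*} [TopologicalSpace G] {I : ModelWithCorners ℝ E G}
  {M : Type*} [TopologicalSpace M] [ChartedSpace G M] [IsManifold I ∞ M]
  {E' : Type*} [NormedAddCommGroup E'] [NormedSpace ℝ E'] [FiniteDimensional ℝ E']
  {G' : Type*} [TopologicalSpace G'] {J : ModelWithCorners ℝ E' G'}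
  {N : Type*} [TopologicalSpace N] [ChartedSpace G' N] [IsManifold J ∞ N]

theorem contMDiffAt_mfderiv_apply {m n : WithTop ℕ∞} {φ : M → N} {x : M}
    {X : Π x : M, TangentSpace I x} (hφ : CMDiffAt n φ x) (hX : CMDiffAt m (T% X) x)
    (hmn : m + 1 ≤ n) :
    ContMDiffAt I J.tangent m
      (fun y ↦ (TotalSpace.mk' E' (φ y) (mfderiv I J φ y (X y)) : TangentBundle J N)) x :=
  ContMDiffAt.clm_apply_of_inCoordinates (hφ.mfderiv_const hmn) hX
    (hφ.of_le (le_trans le_self_add hmn))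

theorem contMDiffAt_mvfderiv_apply {F : Type*} [NormedAddCommGroup F] [NormedSpace ℝ F]
    {m n : WithTop ℕ∞} {f : M → F} {x : M}
    {X : Π x : M, TangentSpace I x} (hf : CMDiffAt n f x) (hX : CMDiffAt m (T% X) x)
    (hmn : m + 1 ≤ n) : CMDiffAt m (fun y ↦ mvfderiv I f y (X y)) x := by
  have h : ContMDiffAt I (𝓘(ℝ, F)).tangent m
      (fun y ↦ (TotalSpace.mk' F (f y) (mfderiv I 𝓘(ℝ, F) f y (X y)) :
        TangentBundle 𝓘(ℝ, F) F)) x :=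
    ContMDiffAt.clm_apply_of_inCoordinates (hf.mfderiv_const hmn) hX
      (hf.of_le (le_trans le_self_add hmn))
  exact (contMDiff_snd_tangentBundle_modelSpace F 𝓘(ℝ, F)).contMDiffAt.comp x h

theorem eventually_contMDiffAt {φ : M → N} {V : Π x : M, TangentSpace J (φ x)} {x : M}
    (hV : ContMDiffAt I J.tangent 2 (fun y ↦ (TotalSpace.mk' E' (φ y) (V y) : TangentBundle J N))
      x) :
    ∀ᶠ z in nhds x,
      ContMDiffAt I J.tangent 2 (fun y ↦ (TotalSpace.mk' E' (φ y) (V y) : TangentBundle J N))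
        z := by
  have : ContMDiffVectorBundle 2 E' (TangentSpace J : N → Type _) J := inferInstance
  exact (contMDiffAt_iff_contMDiffAt_nhds (by simp)).1 hV

variable [RiemannianBundle (fun x : M ↦ TangentSpace I x)]
  [IsContMDiffRiemannianBundle I ∞ E (fun x : M ↦ TangentSpace I x)]

theorem contMDiffAt_inner {n : WithTop ℕ∞} [IsContMDiffRiemannianBundle I n E
    (fun x : M ↦ TangentSpace I x)]
   {X Y : Π x : M, TangentSpace I x} {x : M} (hX : CMDiffAt n (T% X) x) (hY : CMDiffAt n (T% Y) x) :
    CMDiffAt n (fun y ↦ inner ℝ (X y) (Y y)) x :=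
  ContMDiffAt.inner_bundle (E := fun x : M ↦ TangentSpace I x) hX hY

theorem gramSchmidtNormed_eq_smul {ι F : Type*} [NormedAddCommGroup F] [InnerProductSpace ℝ F]
    [LinearOrder ι] [LocallyFiniteOrderBot ι] [WellFoundedLT ι] (f : ι → F) (i : ι) :
    InnerProductSpace.gramSchmidtNormed ℝ f i =
      (Real.sqrt (inner ℝ (InnerProductSpace.gramSchmidt ℝ f i)
        (InnerProductSpace.gramSchmidt ℝ f i)))⁻¹ • InnerProductSpace.gramSchmidt ℝ f i := by
  rw [InnerProductSpace.gramSchmidtNormed, norm_eq_sqrt_real_inner]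
  rfl

/-- Gram-Schmidt applied to a trivialization frame. The basis `onb` is chosen point by point and
need not vary continuously, so every regularity argument passes through such a frame. -/
theorem exists_orthonormal_frame (x : M) :
    ∃ (e : Fin (finrank ℝ E) → Π y : M, TangentSpace I y) (U : Set M), IsOpen U ∧ x ∈ U ∧
      ∀ y ∈ U, Orthonormal ℝ (fun i ↦ e i y) ∧ ∀ i, CMDiffAt ∞ (T% (e i)) y := by
  let t := trivializationAt E (TangentSpace I : M → Type _) x
  let b := finBasis ℝ E
  let Z := t.localFrame b
  have hl := t.isLocalFrameOn_localFrame_baseSet I ∞ b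
  refine ⟨fun i y ↦ InnerProductSpace.gramSchmidtNormed ℝ (fun j ↦ Z j y) i, t.baseSet,
      t.open_baseSet,
    FiberBundle.mem_baseSet_trivializationAt' x, fun y hy ↦ ?_⟩
  have hli := hl.linearIndependent hy
  refine ⟨InnerProductSpace.gramSchmidtNormed_orthonormal hli, ?_⟩
  have hne : ∀ i, InnerProductSpace.gramSchmidt ℝ (fun j ↦ Z j y) i ≠ 0 := fun i ↦
    InnerProductSpace.gramSchmidt_ne_zero i hli
  have hZ : ∀ i, CMDiffAt ∞ (T% (Z i)) y := fun i ↦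
    hl.contMDiffAt t.open_baseSet hy i
  -- The unnormalized vectors are handled first, by induction on the index: each projection
  -- coefficient has the nonvanishing denominator ⟨g_j, g_j⟩.
  have key : ∀ i, CMDiffAt ∞
      (T% (fun y ↦ InnerProductSpace.gramSchmidt ℝ (fun j ↦ Z j y) i)) y := by
    intro i
    induction i using WellFoundedLT.induction with
    | ind i ih =>
    have e : ∀ z, InnerProductSpace.gramSchmidt ℝ (fun j ↦ Z j z) i =
        (Z i - fun y ↦ ∑ j ∈ Finset.Iio i,
          ((fun y ↦ inner ℝ (InnerProductSpace.gramSchmidt ℝ (fun j ↦ Z j y) j) (Z i y) *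
          (inner ℝ (InnerProductSpace.gramSchmidt ℝ (fun j ↦ Z j y) j)
            (InnerProductSpace.gramSchmidt ℝ (fun j ↦ Z j y) j))⁻¹) •
          (fun y ↦ InnerProductSpace.gramSchmidt ℝ (fun j ↦ Z j y) j)) y) z := by
      intro z
      rw [InnerProductSpace.gramSchmidt_def]
      simp [Submodule.starProjection_singleton, div_eq_mul_inv]
    refine ContMDiffAt.congr_of_eventuallyEq ?_ (.of_forall fun z ↦ congrArg _ (e z))
    refine ContMDiffAt.sub_section (hZ i) (ContMDiffAt.sum_section fun j hj ↦ ?_)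
    have hj' := ih j (Finset.mem_Iio.1 hj)
    refine ContMDiffAt.smul_section ?_ hj'
    refine ContMDiffAt.mul (contMDiffAt_inner hj' (hZ i)) ?_
    exact ContMDiffAt.inv₀ (contMDiffAt_inner hj' hj') (by simpa using hne j)
  intro i
  have h2 := contMDiffAt_inner (key i) (key i)
  have h3 : CMDiffAt ∞ (fun y ↦ (Real.sqrt (inner ℝ (InnerProductSpace.gramSchmidt ℝ
      (fun j ↦ Z j y) i)
            (InnerProductSpace.gramSchmidt ℝ (fun j ↦ Z j y) i)))⁻¹) y := by
    have h4 : 0 < inner ℝ (InnerProductSpace.gramSchmidt ℝ (fun j ↦ Z j y) i)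
            (InnerProductSpace.gramSchmidt ℝ (fun j ↦ Z j y) i) := by
      rw [real_inner_self_eq_norm_sq]
      exact pow_pos (norm_pos_iff.2 (hne i)) 2
    refine ContMDiffAt.inv₀ ?_ (Real.sqrt_pos.2 h4).ne'
    exact ContMDiffAt.comp (I' := 𝓘(ℝ, ℝ)) y (Real.contDiffAt_sqrt h4.ne').contMDiffAt h2
  refine (h3.smul_section (key i)).congr_of_eventuallyEq (.of_forall fun z ↦ ?_)
  exact congrArg (TotalSpace.mk' E z) <| gramSchmidtNormed_eq_smul _ _

theorem sum_inner_smul_of_orthonormal {x : M} {e : Fin (finrank ℝ E) → TangentSpace I x}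
    (he : Orthonormal ℝ e) (v : TangentSpace I x) : ∑ i, inner ℝ (e i) v • e i = v := by
  have hc : Fintype.card (Fin (finrank ℝ E)) = finrank ℝ (TangentSpace I x) := by
    simp; rfl
  let b := OrthonormalBasis.mk he (he.linearIndependent.span_eq_top_of_card_eq_finrank' hc).ge
  have hb : ∀ i, b i = e i := fun i ↦ by simp [b]
  simpa [hb] using b.sum_repr' v

theorem contMDiffAt_koszul {X Y Z : Π x : M, TangentSpace I x} {x : M} (hX : CMDiffAt 2 (T% X) x)
    (hY : CMDiffAt 2 (T% Y) x) (hZ : CMDiffAt 2 (T% Z) x) :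
    CMDiffAt 1 (fun y ↦ koszul X Y Z y) x := by
  have h12 : (1 : WithTop ℕ∞) + 1 ≤ 2 := by norm_num
  have hi : ∀ {X Y Z : Π x : M, TangentSpace I x}, CMDiffAt 2 (T% X) x → CMDiffAt 2 (T% Y) x →
      CMDiffAt 2 (T% Z) x → CMDiffAt 1 (fun y ↦ mvfderiv I (fun z ↦ inner ℝ (Y z) (Z z)) y (X y))
          x :=
    fun hX hY hZ ↦ contMDiffAt_mvfderiv_apply (contMDiffAt_inner hY hZ) (hX.of_le one_le_two) h12
  have hm : IsManifold I (minSmoothness ℝ 2) M := by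
    rw [minSmoothness_of_isRCLikeNormedField]; infer_instance
  have hm' : IsManifold I ((2 : ℕ∞) + 1) M := IsManifold.of_le (n := ∞) (by norm_cast)
  have hb : ∀ {X Y Z : Π x : M, TangentSpace I x}, CMDiffAt 2 (T% X) x → CMDiffAt 2 (T% Y) x →
      CMDiffAt 2 (T% Z) x →
      CMDiffAt 1 (fun y ↦ inner ℝ (VectorField.mlieBracket I X Y y) (Z y)) x :=
    fun hX hY hZ ↦ contMDiffAt_inner
      (ContMDiffAt.mlieBracket_vectorField (m := 1) (n := 2) hX hY (by simp; norm_num))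
          (hZ.of_le one_le_two)
  exact (((((hi hX hY hZ).add (hi hY hZ hX)).sub (hi hZ hX hY)).add (hb hX hY hZ)).sub
    (hb hY hZ hX)).add (hb hZ hX hY)

/-- In a smooth orthonormal frame the coefficients are half the Koszul expressions, which involve
one derivative of the fields. -/
theorem contMDiffAt_leviCivita {X Y : Π x : M, TangentSpace I x} {x : M} (hX : CMDiffAt 2 (T% X) x)
    (hY : CMDiffAt 2 (T% Y) x) :
    CMDiffAt 1 (T% (fun y ↦ leviCivita Y y (X y))) x := by
  obtain ⟨e, U, hU, hxU, he⟩ := exists_orthonormal_frame (I := I) x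
  have key : CMDiffAt 1 (T% (fun y ↦ ∑ i, ((fun y ↦ koszul X Y (e i) y / 2) • e i) y)) x := by
    refine ContMDiffAt.sum_section fun i _ ↦ ContMDiffAt.smul_section ?_
      (((he x hxU).2 i).of_le ENat.LEInfty.out)
    exact (contMDiffAt_koszul hX hY (((he x hxU).2 i).of_le ENat.LEInfty.out)).div_const 2
  refine key.congr_of_eventuallyEq ?_
  filter_upwards [hU.mem_nhds hxU, eventually_contMDiffAt hX, eventually_contMDiffAt hY] with
    y hy hXy hYy
  have h2 : (2 : WithTop ℕ∞) ≠ 0 := by simp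
  congr 1
  rw [← sum_inner_smul_of_orthonormal (he y hy).1 (leviCivita Y y (X y))]
  refine Finset.sum_congr rfl fun i _ ↦ ?_
  have := two_mul_inner_leviCivita (hXy.mdifferentiableAt h2) (hYy.mdifferentiableAt h2)
    (((he y hy).2 i).mdifferentiableAt (by simp))
  simp only [Pi.smul_apply', ← this, real_inner_comm (e i y)]
  congr 1
  ring

end Smoothness

/-! ### Sections along a map. -/

section Along

variable {E : Type*} [NormedAddCommGroup E] [NormedSpace ℝ E] [FiniteDimensional ℝ E]
  {G : Type*} [TopologicalSpace G] {I : ModelWithCorners ℝ E G}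
  {M : Type*} [TopologicalSpace M] [ChartedSpace G M] [IsManifold I ∞ M]
  {E' : Type*} [NormedAddCommGroup E'] [NormedSpace ℝ E'] [FiniteDimensional ℝ E']
  {G' : Type*} [TopologicalSpace G'] {J : ModelWithCorners ℝ E' G'}
  {N : Type*} [TopologicalSpace N] [ChartedSpace G' N] [IsManifold J ∞ N]

variable (I J) in
/-- Differentiability at `x` of a section `V` along the map `φ`. -/
abbrev MDiffAlong (φ : M → N) (V : Π y : M, TangentSpace J (φ y)) (x : M) : Prop :=
  MDifferentiableAt I J.tangent
    (fun y ↦ (TotalSpace.mk' E' (φ y) (V y) : TangentBundle J N)) x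

variable (I J) in
/-- `C^n` regularity at `x` of a section `V` along the map `φ`. -/
abbrev CMDiffAlong (n : WithTop ℕ∞) (φ : M → N) (V : Π y : M, TangentSpace J (φ y)) (x : M) :
    Prop :=
  ContMDiffAt I J.tangent n
    (fun y ↦ (TotalSpace.mk' E' (φ y) (V y) : TangentBundle J N)) x

variable {φ : M → N} {V W : Π y : M, TangentSpace J (φ y)} {x : M} {f : M → ℝ} {n : WithTop ℕ∞}

theorem mvfderiv_comp_apply {F : Type*} [NormedAddCommGroup F] [NormedSpace ℝ F] {g : N → F}
    (hg : MDiffAt g (φ x)) (hφ : MDiffAt φ x) (v : TangentSpace I x) :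
    mvfderiv I (fun y ↦ g (φ y)) x v = mvfderiv J g (φ x) (mfderiv I J φ x v) := by
  change mfderiv I 𝓘(ℝ, F) (g ∘ φ) x v = mfderiv J 𝓘(ℝ, F) g (φ x) (mfderiv I J φ x v)
  rw [mfderiv_comp x hg hφ]
  rfl

theorem trivialization_add (t : Trivialization E' (π E' (TangentSpace J : N → Type _)))
    [t.IsLinear ℝ]
    {p : N} (hp : p ∈ t.baseSet) (v w : TangentSpace J p) :
    (t (TotalSpace.mk' E' p (v + w))).2 = (t (TotalSpace.mk' E' p v)).2 +
        (t (TotalSpace.mk' E' p w)).2 :=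
  (t.linear ℝ hp).map_add v w

theorem trivialization_smul (t : Trivialization E' (π E' (TangentSpace J : N → Type _)))
    [t.IsLinear ℝ]
    {p : N} (hp : p ∈ t.baseSet) (c : ℝ) (v : TangentSpace J p) :
    (t (TotalSpace.mk' E' p (c • v))).2 = c • (t (TotalSpace.mk' E' p v)).2 :=
  (t.linear ℝ hp).map_smul c v

theorem trivialization_symm_add (t : Trivialization E' (π E' (TangentSpace J : N → Type _)))
    [t.IsLinear ℝ] {p : N} (hp : p ∈ t.baseSet) (v w : E') :
    (t.symm p (v + w) : TangentSpace J p) = t.symm p v + t.symm p w := by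
  simpa only [t.coe_symmₗ hp] using (t.symmₗ ℝ p).map_add v w

theorem trivialization_symm_smul (t : Trivialization E' (π E' (TangentSpace J : N → Type _)))
    [t.IsLinear ℝ] {p : N} (hp : p ∈ t.baseSet) (c : ℝ) (v : E') :
    (t.symm p (c • v) : TangentSpace J p) = c • t.symm p v := by
  simpa only [t.coe_symmₗ hp] using (t.symmₗ ℝ p).map_smul c v

theorem eventually_mem_baseSet (p : N) :
    ∀ᶠ q in nhds p, q ∈ (trivializationAt E' (TangentSpace J : N → Type _) p).baseSet :=
  (trivializationAt E' (TangentSpace J : N → Type _) p).open_baseSet.mem_nhds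
    (FiberBundle.mem_baseSet_trivializationAt' p)

/-- An extension has constant coordinates over the base set of the trivialization, where the fibre
coordinate is linear. -/
theorem eventually_extend_add {p : N} (v w : TangentSpace J p) :
    ∀ᶠ q in nhds p, (FiberBundle.extend E' (v + w) q : TangentSpace J q) =
      (FiberBundle.extend E' v + FiberBundle.extend E' w : Π q : N, TangentSpace J q) q := by
  filter_upwards [eventually_mem_baseSet (J := J) p] with q hq
  have h := trivialization_add (trivializationAt E' (TangentSpace J : N → Type _) p)
    (FiberBundle.mem_baseSet_trivializationAt' p) v w
  simp only [FiberBundle.extend, Pi.add_apply]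
  rw [h, trivialization_symm_add _ hq]

theorem eventually_extend_smul {p : N} (c : ℝ) (v : TangentSpace J p) :
    ∀ᶠ q in nhds p, (FiberBundle.extend E' (c • v) q : TangentSpace J q) =
      ((fun _ : N ↦ c) • FiberBundle.extend E' v : Π q : N, TangentSpace J q) q := by
  filter_upwards [eventually_mem_baseSet (J := J) p] with q hq
  have h := trivialization_smul (trivializationAt E' (TangentSpace J : N → Type _) p)
    (FiberBundle.mem_baseSet_trivializationAt' p) c v
  simp only [FiberBundle.extend, Pi.smul_apply']
  rw [h, trivialization_symm_smul _ hq]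

theorem MDiffAlong.base (hV : MDiffAlong I J φ V x) : MDiffAt φ x :=
  ((mdifferentiableAt_totalSpace _ _).1 hV).1

theorem MDiffAlong.eventually_mem_baseSet (hV : MDiffAlong I J φ V x) :
    ∀ᶠ y in nhds x, φ y ∈ (trivializationAt E' (TangentSpace J : N → Type _) (φ x)).baseSet :=
  hV.base.continuousAt.eventually_mem ((trivializationAt E' _ (φ x)).open_baseSet.mem_nhds
    (FiberBundle.mem_baseSet_trivializationAt' (φ x)))

theorem MDiffAlong.snd (hV : MDiffAlong I J φ V x) : MDiffAt (fun y ↦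
    (trivializationAt E' (TangentSpace J : N → Type _) (φ x) (TotalSpace.mk' E' (φ y) (V y))).2)
      x :=
  ((mdifferentiableAt_totalSpace _ _).1 hV).2

theorem MDiffAlong.add (hV : MDiffAlong I J φ V x) (hW : MDiffAlong I J φ W x) :
    MDiffAlong I J φ (V + W) x := by
  refine (mdifferentiableAt_totalSpace _ _).2 ⟨hV.base, ?_⟩
  refine (hV.snd.add hW.snd).congr_of_eventuallyEq ?_
  filter_upwards [hV.eventually_mem_baseSet] with y hy
  exact trivialization_add _ hy _ _

theorem MDiffAlong.smul (hf : MDiffAt f x) (hV : MDiffAlong I J φ V x) :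
    MDiffAlong I J φ (fun y ↦ f y • V y) x := by
  refine (mdifferentiableAt_totalSpace _ _).2 ⟨hV.base, ?_⟩
  refine (hf.smul hV.snd).congr_of_eventuallyEq ?_
  filter_upwards [hV.eventually_mem_baseSet] with y hy
  exact trivialization_smul _ hy _ _

theorem CMDiffAlong.add (hn : n ≠ 0) (hV : CMDiffAlong I J n φ V x) (hW : CMDiffAlong I J n φ W x) :
    CMDiffAlong I J n φ (fun y ↦ V y + W y) x := by
  refine contMDiffAt_totalSpace.2 ⟨(contMDiffAt_totalSpace.1 hV).1, ?_⟩
  refine ((contMDiffAt_totalSpace.1 hV).2.add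
    (contMDiffAt_totalSpace.1 hW).2).congr_of_eventuallyEq ?_
  filter_upwards [MDiffAlong.eventually_mem_baseSet (hV.mdifferentiableAt hn)] with y hy
  exact trivialization_add _ hy _ _

theorem CMDiffAlong.smul (hn : n ≠ 0) (hf : CMDiffAt n f x) (hV : CMDiffAlong I J n φ V x) :
    CMDiffAlong I J n φ (fun y ↦ f y • V y) x := by
  refine contMDiffAt_totalSpace.2 ⟨(contMDiffAt_totalSpace.1 hV).1, ?_⟩
  refine (hf.smul (contMDiffAt_totalSpace.1 hV).2).congr_of_eventuallyEq ?_
  filter_upwards [MDiffAlong.eventually_mem_baseSet (hV.mdifferentiableAt hn)] with y hy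
  exact trivialization_smul _ hy _ _

theorem CMDiffAlong.zero (hφ : CMDiffAt n φ x) :
    CMDiffAlong I J n φ (fun _ ↦ 0) x :=
  (contMDiff_zeroSection ℝ (TangentSpace J : N → Type _)).contMDiffAt.comp x hφ

theorem CMDiffAlong.sum (hn : n ≠ 0) {ι : Type*} (s : Finset ι)
    {V : ι → Π y : M, TangentSpace J (φ y)} (hφ : CMDiffAt n φ x)
    (hV : ∀ i ∈ s, CMDiffAlong I J n φ (V i) x) :
    CMDiffAlong I J n φ (fun y ↦ ∑ i ∈ s, V i y) x := by
  classical
  induction s using Finset.induction_on with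
  | empty => simpa using CMDiffAlong.zero hφ
  | insert a s ha h =>
    simp only [Finset.sum_insert ha]
    exact CMDiffAlong.add hn (hV a (by simp)) (h fun i hi ↦ hV i (by simp [hi]))

section Induction

variable [RiemannianBundle (fun y : N ↦ TangentSpace J y)]
  [IsContMDiffRiemannianBundle J ∞ E' (fun y : N ↦ TangentSpace J y)]

theorem MDiffAlong.inner (hV : MDiffAlong I J φ V x) (hW : MDiffAlong I J φ W x) :
    MDiffAt (fun y ↦ inner ℝ (V y) (W y)) x :=
  MDifferentiableAt.inner_bundle (E := fun x : N ↦ TangentSpace J x) hV hW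

theorem CMDiffAlong.inner [IsContMDiffRiemannianBundle J n E' (fun y : N ↦ TangentSpace J y)]
    (hV : CMDiffAlong I J n φ V x) (hW : CMDiffAlong I J n φ W x) :
    CMDiffAt n (fun y ↦ inner ℝ (V y) (W y)) x :=
  ContMDiffAt.inner_bundle (E := fun x : N ↦ TangentSpace J x) hV hW

theorem MDiffAlong.comp {Y : Π p : N, TangentSpace J p} (hφ : MDiffAt φ x)
    (hY : MDiffAt (T% Y) (φ x)) :
    MDiffAlong I J φ (fun y ↦ Y (φ y)) x :=
  MDifferentiableAt.comp (I' := J) x hY hφ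

theorem CMDiffAlong.comp {Y : Π p : N, TangentSpace J p} (hφ : CMDiffAt n φ x)
    (hY : CMDiffAt n (T% Y) (φ x)) :
    CMDiffAlong I J n φ (fun y ↦ Y (φ y)) x :=
  ContMDiffAt.comp (I' := J) x hY hφ

/-- A property of differentiable sections along a map that is local and stable under linear
combinations with differentiable coefficients holds for all of them, if it holds for restrictions
of fields on the target. -/
theorem MDiffAlong.induction (hV : MDiffAlong I J φ V x)
    (P : (Π y : M, TangentSpace J (φ y)) → Prop)
    (congr : ∀ V W, MDiffAlong I J φ V x → (∀ᶠ y in nhds x, V y = W y) → P V → P W)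
    (add : ∀ V W, MDiffAlong I J φ V x → MDiffAlong I J φ W x → P V → P W →
      P (V + W))
    (smul : ∀ (f : M → ℝ) V, MDiffAt f x → MDiffAlong I J φ V x → P V → P (fun y ↦ f y • V y))
    (comp : ∀ Y : Π p : N, TangentSpace J p, MDiffAt (T% Y) (φ x) → P (fun y ↦ Y (φ y))) :
    P V := by
  classical
  -- Near `x`, V = ∑ ⟨e_a ∘ φ, V⟩ e_a ∘ φ: a combination of restricted fields with differentiable
  -- coefficients. The partial sums carry their differentiability along because `add` asks for it.
  obtain ⟨e, U, hU, hxU, he⟩ := exists_orthonormal_frame (I := J) (φ x)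
  have hd : ∀ a, MDiffAt (T% (e a)) (φ x) := fun a ↦ ((he _ hxU).2 a).mdifferentiableAt (by simp)
  have hc : ∀ a, MDiffAt (fun y ↦ Inner.inner ℝ (e a (φ y)) (V y)) x := fun a ↦
    (MDiffAlong.comp hV.base (hd a)).inner hV
  have key : ∀ s : Finset (Fin (finrank ℝ E')),
      MDiffAlong I J φ (fun y ↦ ∑ a ∈ s, Inner.inner ℝ (e a (φ y)) (V y) • e a (φ y)) x ∧
      P (fun y ↦ ∑ a ∈ s, Inner.inner ℝ (e a (φ y)) (V y) • e a (φ y)) := by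
    intro s
    induction s using Finset.induction_on with
    | empty =>
      have h0 : MDiffAt (T% (0 : Π p : N, TangentSpace J p)) (φ x) :=
          mdifferentiable_zeroSection ℝ _ _
      simpa using And.intro (MDiffAlong.comp hV.base h0) (comp 0 h0)
    | insert a s ha ih =>
      simp only [Finset.sum_insert ha]
      have h1 := MDiffAlong.smul (hc a) (MDiffAlong.comp hV.base (hd a))
      exact ⟨h1.add ih.1, add _ _ h1 ih.1 (smul _ _ (hc a) (.comp hV.base (hd a)) (comp _ (hd a)))
          ih.2⟩
  refine congr _ _ (key Finset.univ).1 ?_ (key Finset.univ).2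
  filter_upwards [hV.base.continuousAt.eventually_mem (hU.mem_nhds hxU)] with y hy
  exact sum_inner_smul_of_orthonormal (he _ hy).1 (V y)

end Induction

end Along

/-! ### The pull-back connection. -/

section CovDeriv

variable {E : Type*} [NormedAddCommGroup E] [NormedSpace ℝ E] [FiniteDimensional ℝ E]
  {G : Type*} [TopologicalSpace G] {I : ModelWithCorners ℝ E G}
  {M : Type*} [TopologicalSpace M] [ChartedSpace G M] [IsManifold I ∞ M]
  {E' : Type*} [NormedAddCommGroup E'] [NormedSpace ℝ E'] [FiniteDimensional ℝ E']
  {G' : Type*} [TopologicalSpace G'] {J : ModelWithCorners ℝ E' G'}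
  {N : Type*} [TopologicalSpace N] [ChartedSpace G' N] [IsManifold J ∞ N]
  [RiemannianBundle (fun y : N ↦ TangentSpace J y)]
  [IsContMDiffRiemannianBundle J ∞ E' (fun y : N ↦ TangentSpace J y)]

variable {φ : M → N} {V W : Π y : M, TangentSpace J (φ y)} {x : M} {f : M → ℝ} {n : WithTop ℕ∞}

theorem leviCivita_extend_add {p : N} (v w u : TangentSpace J p) :
    leviCivita (FiberBundle.extend E' (v + w)) p u =
      leviCivita (FiberBundle.extend E' v) p u + leviCivita (FiberBundle.extend E' w) p u := by
  rw [leviCivita_congr (mdifferentiableAt_extend _) (eventually_extend_add v w),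
    leviCivita_add (mdifferentiableAt_extend _) (mdifferentiableAt_extend _)]

theorem leviCivita_extend_smul {p : N} (c : ℝ) (v u : TangentSpace J p) :
    leviCivita (FiberBundle.extend E' (c • v)) p u =
      c • leviCivita (FiberBundle.extend E' v) p u := by
  rw [leviCivita_congr (mdifferentiableAt_extend _) (eventually_extend_smul c v),
    leviCivita_smul mdifferentiableAt_const (mdifferentiableAt_extend _)]
  simp [mvfderiv_const]

/-- The Levi-Civita connection in terms of its values on the fields that are constant in a
trivialization. -/
theorem leviCivita_eq_symm_add {Y : Π p : N, TangentSpace J p} {p : N} (hY : MDiffAt (T% Y) p)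
    (u : TangentSpace J p) :
    leviCivita Y p u = (trivializationAt E' (TangentSpace J : N → Type _) p).symm p
      (mvfderiv J (fun q ↦ (trivializationAt E' (TangentSpace J : N → Type _) p
        (TotalSpace.mk' E' q (Y q))).2) p u) + leviCivita (FiberBundle.extend E' (Y p)) p u := by
  let t := trivializationAt E' (TangentSpace J : N → Type _) p
  have hp : p ∈ t.baseSet := FiberBundle.mem_baseSet_trivializationAt' p
  -- The difference between ∇ and the flat derivative of the trivialization is tensorial. It can
  -- thus be evaluated on the extension of `Y p`, whose flat derivative vanishes.
  let D : (Π p : N, TangentSpace J p) → TangentSpace J p := fun Y ↦ leviCivita Y p u -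
    t.symm p (mvfderiv J (fun q ↦ (t (TotalSpace.mk' E' q (Y q))).2) p u)
  have hs : ∀ {Y : Π p : N, TangentSpace J p}, MDiffAt (T% Y) p →
      MDiffAt (fun q ↦ (t (TotalSpace.mk' E' q (Y q))).2) p := fun hY ↦
    ((mdifferentiableAt_section _ _).1 hY)
  have hD : TensorialAt J E' D p := by
    refine ⟨fun {f Y} hf hY ↦ ?_, fun {Y Z} hY hZ ↦ ?_⟩
    · have e : (fun q ↦ (t (TotalSpace.mk' E' q ((f • Y) q))).2) =ᶠ[nhds p]
          (f • fun q ↦ (t (TotalSpace.mk' E' q (Y q))).2) := by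
        filter_upwards [eventually_mem_baseSet (J := J) p] with q hq
        exact trivialization_smul t hq _ _
      simp only [D]
      rw [mvfderiv_congr e, mvfderiv_smul hf (hs hY), leviCivita_smul hf hY]
      simp only [_root_.add_apply, ContinuousLinearMap.smulRight_apply, _root_.smul_apply]
      rw [trivialization_symm_add t hp, trivialization_symm_smul t hp,
        trivialization_symm_smul t hp,
        Trivialization.symm_apply_apply_mk t hp]
      module
    · have e : (fun q ↦ (t (TotalSpace.mk' E' q ((Y + Z) q))).2) =ᶠ[nhds p]
          ((fun q ↦ (t (TotalSpace.mk' E' q (Y q))).2) + fun q ↦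
              (t (TotalSpace.mk' E' q (Z q))).2) := by
        filter_upwards [eventually_mem_baseSet (J := J) p] with q hq
        exact trivialization_add t hq _ _
      simp only [D]
      rw [mvfderiv_congr e, mvfderiv_add (hs hY) (hs hZ), leviCivita_add hY hZ]
      simp only [_root_.add_apply]
      rw [trivialization_symm_add t hp]
      module
  have h := hD.pointwise hY (mdifferentiableAt_extend (Y p)) (by simp)
  have e : (fun q ↦ (t (TotalSpace.mk' E' q (FiberBundle.extend E' (Y p) q))).2) =ᶠ[nhds p]
      fun _ ↦ (t (TotalSpace.mk' E' p (Y p))).2 := by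
    filter_upwards [eventually_mem_baseSet (J := J) p] with q hq
    have h1 := congrArg Prod.snd (t.apply_mk_symm hq (t (TotalSpace.mk' E' p (Y p))).2)
    exact h1
  simp only [D] at h
  rw [mvfderiv_congr e, mvfderiv_const] at h
  have h0 : (t.symm p (0 : E') : TangentSpace J p) = 0 := by
    simpa using trivialization_symm_smul t hp 0 0
  rw [zero_apply, h0, sub_zero] at h
  rw [← h]
  simp only [t]
  abel

theorem covDerivAlong_congr (h : ∀ᶠ y in nhds x, V y = W y)
    (v : TangentSpace I x) : covDerivAlong I J φ V x v = covDerivAlong I J φ W x v := by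
  have e : (fun y ↦ (trivializationAt E' (TangentSpace J : N → Type _) (φ x)
      (TotalSpace.mk' E' (φ y) (V y))).2) =ᶠ[nhds x] fun y ↦
        (trivializationAt E' (TangentSpace J : N → Type _) (φ x)
          (TotalSpace.mk' E' (φ y) (W y))).2 := h.mono fun y hy ↦ by simp only [hy]
  simp only [covDerivAlong]
  rw [mvfderiv_congr e, h.self_of_nhds]

theorem covDerivAlong_add (hV : MDiffAlong I J φ V x) (hW : MDiffAlong I J φ W x)
    (v : TangentSpace I x) : covDerivAlong I J φ (V + W) x v =
      covDerivAlong I J φ V x v + covDerivAlong I J φ W x v := by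
  let t := trivializationAt E' (TangentSpace J : N → Type _) (φ x)
  have hp : φ x ∈ t.baseSet := FiberBundle.mem_baseSet_trivializationAt' (φ x)
  have e : (fun y ↦ (t (TotalSpace.mk' E' (φ y) ((V + W) y))).2) =ᶠ[nhds x]
      ((fun y ↦ (t (TotalSpace.mk' E' (φ y) (V y))).2) +
        fun y ↦ (t (TotalSpace.mk' E' (φ y) (W y))).2) := by
    filter_upwards [hV.eventually_mem_baseSet] with y hy
    exact trivialization_add t hy _ _
  simp only [covDerivAlong]
  rw [mvfderiv_congr e, mvfderiv_add hV.snd hW.snd, _root_.add_apply,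
    trivialization_symm_add t hp, Pi.add_apply, leviCivita_extend_add]
  abel

theorem covDerivAlong_smul (hf : MDiffAt f x) (hV : MDiffAlong I J φ V x) (v : TangentSpace I x) :
    covDerivAlong I J φ (fun y ↦ f y • V y) x v =
      f x • covDerivAlong I J φ V x v + mvfderiv I f x v • V x := by
  let t := trivializationAt E' (TangentSpace J : N → Type _) (φ x)
  have hp : φ x ∈ t.baseSet := FiberBundle.mem_baseSet_trivializationAt' (φ x)
  have e : (fun y ↦ (t (TotalSpace.mk' E' (φ y) (f y • V y))).2) =ᶠ[nhds x]
      (f • fun y ↦ (t (TotalSpace.mk' E' (φ y) (V y))).2) := by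
    filter_upwards [hV.eventually_mem_baseSet] with y hy
    exact trivialization_smul t hy _ _
  simp only [covDerivAlong]
  rw [mvfderiv_congr e, mvfderiv_smul hf hV.snd, leviCivita_extend_smul]
  simp only [_root_.add_apply, ContinuousLinearMap.smulRight_apply, _root_.smul_apply]
  rw [trivialization_symm_add t hp, trivialization_symm_smul t hp, trivialization_symm_smul t hp,
    Trivialization.symm_apply_apply_mk t hp]
  module

/-- This ties the coordinate definition to the connection of the target. With `MDiffAlong.induction`
it transfers metric compatibility to the pull-back bundle. -/
theorem covDerivAlong_comp {Y : Π p : N, TangentSpace J p} (hφ : MDiffAt φ x)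
    (hY : MDiffAt (T% Y) (φ x)) (v : TangentSpace I x) :
    covDerivAlong I J φ (fun y ↦ Y (φ y)) x v = leviCivita Y (φ x) (mfderiv I J φ x v) := by
  rw [leviCivita_eq_symm_add hY]
  simp only [covDerivAlong]
  rw [← mvfderiv_comp_apply ((mdifferentiableAt_section _ _).1 hY) hφ]

theorem covDerivAlong_add_dir (v w : TangentSpace I x) :
    covDerivAlong I J φ V x (v + w) = covDerivAlong I J φ V x v + covDerivAlong I J φ V x w := by
  simp only [covDerivAlong, map_add]
  rw [trivialization_symm_add _ (FiberBundle.mem_baseSet_trivializationAt' (φ x)),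
    leviCivita_add_dir (mdifferentiableAt_extend _)]
  abel

theorem covDerivAlong_smul_dir (c : ℝ) (v : TangentSpace I x) :
    covDerivAlong I J φ V x (c • v) = c • covDerivAlong I J φ V x v := by
  simp only [covDerivAlong, map_smul]
  rw [trivialization_symm_smul _ (FiberBundle.mem_baseSet_trivializationAt' (φ x)),
    leviCivita_smul_dir (mdifferentiableAt_extend _), smul_add]

/-- The connection of the pull-back bundle is compatible with the metric. -/
theorem mvfderiv_inner_along (hV : MDiffAlong I J φ V x) (hW : MDiffAlong I J φ W x)
    (v : TangentSpace I x) :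
    mvfderiv I (fun y ↦ inner ℝ (V y) (W y)) x v =
      inner ℝ (covDerivAlong I J φ V x v) (W x) + inner ℝ (V x) (covDerivAlong I J φ W x v) := by
  have hφ := hV.base
  have hs : ∀ V W : Π y : M, TangentSpace J (φ y),
      (fun y ↦ inner ℝ (V y) (W y)) = fun y ↦ inner ℝ (W y) (V y) :=
    fun V W ↦ funext fun y ↦ real_inner_comm _ _
  -- Reduction of one argument to restrictions of fields on the target. It is used twice, with the
  -- roles of `V` and `W` exchanged.
  have step : ∀ W : Π y : M, TangentSpace J (φ y), MDiffAlong I J φ W x →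
      (∀ Y : Π p : N, TangentSpace J p, MDiffAt (T% Y) (φ x) →
        mvfderiv I (fun y ↦ inner ℝ (Y (φ y)) (W y)) x v =
        inner ℝ (covDerivAlong I J φ (fun y ↦ Y (φ y)) x v) (W x) +
          inner ℝ (Y (φ x)) (covDerivAlong I J φ W x v)) →
      ∀ V, MDiffAlong I J φ V x → mvfderiv I (fun y ↦ inner ℝ (V y) (W y)) x v =
        inner ℝ (covDerivAlong I J φ V x v) (W x) +
          inner ℝ (V x) (covDerivAlong I J φ W x v) := by
    intro W hW hcomp V hV
    refine hV.induction (fun V ↦ mvfderiv I (fun y ↦ inner ℝ (V y) (W y)) x v =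
        inner ℝ (covDerivAlong I J φ V x v) (W x) +
          inner ℝ (V x) (covDerivAlong I J φ W x v)) ?_ ?_ ?_ hcomp
    · intro V V' hV h hP
      rw [← covDerivAlong_congr h, ← h.self_of_nhds, ← hP]
      have e : (fun y ↦ inner ℝ (V y) (W y)) =ᶠ[nhds x] fun y ↦ inner ℝ (V' y) (W y) :=
        h.mono fun y hy ↦ by simp only [hy]
      rw [mvfderiv_congr e]
    · intro V V' hV hV' h h'
      have e : (fun y ↦ inner ℝ ((V + V') y) (W y)) =
          (fun y ↦ inner ℝ (V y) (W y)) + fun y ↦ inner ℝ (V' y) (W y) := by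
        ext y; simp [inner_add_left]
      rw [e, mvfderiv_add (hV.inner hW) (hV'.inner hW), covDerivAlong_add hV hV']
      simp only [_root_.add_apply, Pi.add_apply, inner_add_left, h, h']
      ring
    · intro f V hf hV h
      have e : (fun y ↦ inner ℝ (f y • V y) (W y)) = f * fun y ↦ inner ℝ (V y) (W y) := by
        ext y; simp [inner_smul_left]
      rw [e, mvfderiv_mul hf (hV.inner hW), covDerivAlong_smul hf hV]
      simp [inner_add_left, inner_smul_left, h]
      ring
  refine step W hW (fun Y hY ↦ ?_) V hV
  have hYφ := MDiffAlong.comp hφ hY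
  rw [hs, real_inner_comm (W x), real_inner_comm _ (Y (φ x)), add_comm]
  refine step _ hYφ (fun Z hZ ↦ ?_) W hW
  rw [mvfderiv_comp_apply (g := fun p ↦ inner ℝ (Z p) (Y p)) (mdifferentiableAt_inner hZ hY) hφ,
    mvfderiv_inner hZ hY, covDerivAlong_comp hφ hZ, covDerivAlong_comp hφ hY]

end CovDeriv

/-! ### Chart-constant fields and symmetry of second derivatives. -/

section ConstantFields

variable {E : Type*} [NormedAddCommGroup E] [NormedSpace ℝ E] [FiniteDimensional ℝ E]
  {G : Type*} [TopologicalSpace G] {I : ModelWithCorners ℝ E G}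
  {M : Type*} [TopologicalSpace M] [ChartedSpace G M] [IsManifold I ∞ M] {x : M}

theorem mfderiv_extChartAt_apply {y : M} (hy : y ∈ (chartAt G x).source) (u : TangentSpace I y) :
    (mfderiv I 𝓘(ℝ, E) (extChartAt I x) y u : E) =
      (trivializationAt E (TangentSpace I) x (TotalSpace.mk' E y u)).2 := by
  have h := DFunLike.congr_fun (TangentBundle.continuousLinearMapAt_trivializationAt (I := I) hy) u
  exact h.symm.trans (Trivialization.continuousLinearMapAt_apply_of_mem ℝ _ hy u)

theorem extend_eq_mfderivWithin (w : TangentSpace I x) {y : M} (hy : y ∈ (chartAt G x).source) :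
    (FiberBundle.extend E w y : TangentSpace I y) =
      mfderivWithin 𝓘(ℝ, E) I (extChartAt I x).symm (Set.range I) (extChartAt I x y)
        (trivializationAt E (TangentSpace I) x (TotalSpace.mk' E x w)).2 := by
  have h := DFunLike.congr_fun (TangentBundle.symmL_trivializationAt (I := I) hy)
    (trivializationAt E (TangentSpace I) x (TotalSpace.mk' E x w)).2
  exact (Trivialization.symmL_apply _ hy _).symm.trans h

/-- The trivialization at `x` is the differential of the chart at `x`, so an extension is a constant
vector field in that chart. Both the vanishing of brackets and the formula for second derivatives
rest on this. -/
theorem mpullbackWithin_extend (w : TangentSpace I x) {z : E} (hz : z ∈ (extChartAt I x).target) :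
    VectorField.mpullbackWithin 𝓘(ℝ, E) I (extChartAt I x).symm
      (FiberBundle.extend E w : Π y : M, TangentSpace I y) (Set.range I) z =
      (trivializationAt E (TangentSpace I) x (TotalSpace.mk' E x w)).2 := by
  have hs : (extChartAt I x).symm z ∈ (chartAt G x).source := by
    simpa using (extChartAt I x).map_target hz
  rw [VectorField.mpullbackWithin_apply, extend_eq_mfderivWithin w hs,
    (extChartAt I x).right_inv hz]
  exact (isInvertible_mfderivWithin_extChartAt_symm hz).inverse_apply_self _

theorem mlieBracket_extend (v w : TangentSpace I x) :
    VectorField.mlieBracket I (FiberBundle.extend E v) (FiberBundle.extend E w) x = 0 := by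
  have h : ∀ w : TangentSpace I x, VectorField.mpullbackWithin 𝓘(ℝ, E) I (extChartAt I x).symm
      (FiberBundle.extend E w : Π y : M, TangentSpace I y) (Set.range I)
      =ᶠ[nhdsWithin (extChartAt I x x) (Set.range I)] fun _ ↦
      (trivializationAt E (TangentSpace I) x (TotalSpace.mk' E x w)).2 := fun w ↦ by
    filter_upwards [extChartAt_target_mem_nhdsWithin (I := I) x] with z hz
    exact mpullbackWithin_extend w hz
  rw [← VectorField.mlieBracketWithin_univ, VectorField.mlieBracketWithin_apply, Set.preimage_univ,
    Set.univ_inter, Filter.EventuallyEq.lieBracketWithin_vectorField_eq_of_mem (h v) (h w)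
        (by simp)]
  simp only [VectorField.lieBracketWithin, fderivWithin_fun_const, Pi.zero_apply, zero_apply,
      sub_zero]
  exact map_zero _

/-- Differentiating twice along chart-constant fields produces no first-order term. Without
boundary, `Set.range I` is everything and ordinary Fréchet derivatives suffice. -/
theorem mvfderiv_mvfderiv_extend [I.Boundaryless] {F : Type*} [NormedAddCommGroup F]
    [NormedSpace ℝ F]
    {ψ : M → F} (hψ : CMDiffAt 2 ψ x) (v w : TangentSpace I x) :
    mvfderiv I (fun y ↦ mvfderiv I ψ y (FiberBundle.extend E w y)) x v =
      fderiv ℝ (fderiv ℝ (ψ ∘ (extChartAt I x).symm)) (extChartAt I x x)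
        (trivializationAt E (TangentSpace I) x (TotalSpace.mk' E x v)).2
        (trivializationAt E (TangentSpace I) x (TotalSpace.mk' E x w)).2 := by
  set e := extChartAt I x
  set g := ψ ∘ e.symm
  set v' := (trivializationAt E (TangentSpace I) x (TotalSpace.mk' E x v)).2
  set w' := (trivializationAt E (TangentSpace I) x (TotalSpace.mk' E x w)).2
  have hg : ContDiffAt ℝ 2 g (e x) := by
    have h1 := (contMDiffAt_iff_source (I := I) (x := x)).1 hψ
    rw [I.range_eq_univ, contMDiffWithinAt_univ] at h1
    exact h1.contDiffAt
  have hd : DifferentiableAt ℝ (fderiv ℝ g) (e x) :=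
    (hg.fderiv_right (m := 1) (by norm_num)).differentiableAt (by simp)
  have e1 : (fun y ↦ mvfderiv I ψ y (FiberBundle.extend E w y)) =ᶠ[nhds x]
      fun y ↦ (fun z ↦ fderiv ℝ g z w') (e y) := by
    have hψ' := (contMDiffAt_iff_contMDiffAt_nhds (by simp)).1 hψ
    filter_upwards [hψ', extChartAt_source_mem_nhds (I := I) x] with y hψy hy
    have hy' : y ∈ (chartAt G x).source := by simpa using hy
    rw [extend_eq_mfderivWithin w hy']
    have hs : MDifferentiableWithinAt 𝓘(ℝ, E) I e.symm (Set.range I) (e y) :=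
      mdifferentiableWithinAt_extChartAt_symm (e.map_source hy)
    rw [I.range_eq_univ] at hs ⊢
    rw [mdifferentiableWithinAt_univ] at hs
    have hc := mfderiv_comp_of_eq (hψy.mdifferentiableAt (by simp)) hs (e.left_inv hy)
    rw [mfderivWithin_univ]
    change mfderiv I 𝓘(ℝ, F) ψ y _ = fderiv ℝ g (e y) w'
    rw [← mfderiv_eq_fderiv, hc]
    -- `e.symm (e y)` is only propositionally `y`, so the tangent space in the type has to be
    -- transported.
    have aux : ∀ p, p = y → ∀ u : E, (mfderiv I 𝓘(ℝ, F) ψ y u : F) = mfderiv I 𝓘(ℝ, F) ψ p u := by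
      rintro p rfl u
      rfl
    exact aux _ (e.left_inv hy) _
  rw [mvfderiv_congr e1]
  refine (mvfderiv_comp_apply (J := 𝓘(ℝ, E)) (g := fun z ↦ fderiv ℝ g z w') (φ := e)
    ?_ ?_ v).trans ?_
  · exact (hd.clm_apply (differentiableAt_const _)).mdifferentiableAt
  · exact mdifferentiableAt_extChartAt (mem_chart_source G x)
  · have h1 := mfderiv_extChartAt_apply (I := I) (mem_chart_source G x) v
    rw [h1]
    change mfderiv 𝓘(ℝ, E) 𝓘(ℝ, F) (fun z ↦ fderiv ℝ g z w') (e x) v' = _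
    rw [mfderiv_eq_fderiv, fderiv_clm_apply hd (differentiableAt_const _)]
    simp
    rfl

theorem mvfderiv_mvfderiv_extend_comm [I.Boundaryless] {F : Type*} [NormedAddCommGroup F]
    [NormedSpace ℝ F] {ψ : M → F} (hψ : CMDiffAt 2 ψ x) (v w : TangentSpace I x) :
    mvfderiv I (fun y ↦ mvfderiv I ψ y (FiberBundle.extend E w y)) x v =
      mvfderiv I (fun y ↦ mvfderiv I ψ y (FiberBundle.extend E v y)) x w := by
  rw [mvfderiv_mvfderiv_extend hψ, mvfderiv_mvfderiv_extend hψ]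
  have h1 := (contMDiffAt_iff_source (I := I) (x := x)).1 hψ
  rw [I.range_eq_univ, contMDiffWithinAt_univ] at h1
  exact (h1.contDiffAt.isSymmSndFDerivAt (by simp)) _ _

end ConstantFields

/-! ### Regularity of the pull-back connection. -/

section CovDerivSmooth

variable {E : Type*} [NormedAddCommGroup E] [NormedSpace ℝ E] [FiniteDimensional ℝ E]
  {G : Type*} [TopologicalSpace G] {I : ModelWithCorners ℝ E G}
  {M : Type*} [TopologicalSpace M] [ChartedSpace G M] [IsManifold I ∞ M]
  {E' : Type*} [NormedAddCommGroup E'] [NormedSpace ℝ E'] [FiniteDimensional ℝ E']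
  {G' : Type*} [TopologicalSpace G'] {J : ModelWithCorners ℝ E' G'}
  {N : Type*} [TopologicalSpace N] [ChartedSpace G' N] [IsManifold J ∞ N]
  [RiemannianBundle (fun y : N ↦ TangentSpace J y)]
  [IsContMDiffRiemannianBundle J ∞ E' (fun y : N ↦ TangentSpace J y)]

variable {φ : M → N} {V W : Π y : M, TangentSpace J (φ y)} {x : M}

theorem covDerivAlong_sum (hφ : MDiffAt φ x) {ι : Type*} (s : Finset ι)
    {V : ι → Π y : M, TangentSpace J (φ y)} (hV : ∀ i ∈ s, MDiffAlong I J φ (V i) x)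
    (v : TangentSpace I x) :
    MDiffAlong I J φ (fun y ↦ ∑ i ∈ s, V i y) x ∧
    covDerivAlong I J φ (fun y ↦ ∑ i ∈ s, V i y) x v = ∑ i ∈ s, covDerivAlong I J φ (V i) x v := by
  classical
  induction s using Finset.induction_on with
  | empty =>
    have h0 : MDiffAlong I J φ (fun _ ↦ 0) x :=
      MDiffAlong.comp (Y := 0) hφ (mdifferentiable_zeroSection ℝ _ _)
    have h := covDerivAlong_smul (f := fun _ ↦ (0 : ℝ)) mdifferentiableAt_const h0 v
    simpa using And.intro h0 h
  | insert a s ha ih =>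
    have ih := ih fun i hi ↦ hV i (by simp [hi])
    have ha' := hV a (by simp)
    simp only [Finset.sum_insert ha]
    refine ⟨ha'.add ih.1, ?_⟩
    rw [← ih.2]
    exact covDerivAlong_add ha' ih.1 v

theorem leviCivita_sum_dir {Y : Π p : N, TangentSpace J p} {p : N} (hY : MDiffAt (T% Y) p)
    {ι : Type*} (s : Finset ι) (c : ι → ℝ) (u : ι → TangentSpace J p) :
    leviCivita Y p (∑ i ∈ s, c i • u i) = ∑ i ∈ s, c i • leviCivita Y p (u i) := by
  have h : leviCivita Y p (∑ i ∈ s, c i • u i) = ∑ i ∈ s, leviCivita Y p (c i • u i) :=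
    map_sum (IsLinearMap.mk' (leviCivita Y p)
      ⟨leviCivita_add_dir hY, leviCivita_smul_dir hY⟩) (fun i ↦ c i • u i) s
  simp only [h, leviCivita_smul_dir hY]

/-- The derivative of a section along a map, in an orthonormal frame of the target. -/
theorem covDerivAlong_eq_sum (hφ : MDiffAt φ x) (hV : MDiffAlong I J φ V x)
    {e : Fin (finrank ℝ E') → Π p : N, TangentSpace J p}
    (he : ∀ᶠ p in nhds (φ x), Orthonormal ℝ fun a ↦ e a p) (hd : ∀ a, MDiffAt (T% (e a)) (φ x))
    (v : TangentSpace I x) :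
    covDerivAlong I J φ V x v = ∑ a, (inner ℝ (e a (φ x)) (V x) •
      ∑ b, inner ℝ (e b (φ x)) (mfderiv I J φ x v) • leviCivita (e a) (φ x) (e b (φ x)) +
        mvfderiv I (fun y ↦ inner ℝ (e a (φ y)) (V y)) x v • e a (φ x)) := by
  have hc : ∀ a, MDiffAt (fun y ↦ inner ℝ (e a (φ y)) (V y)) x := fun a ↦
    (MDiffAlong.comp hφ (hd a)).inner hV
  have h : ∀ᶠ y in nhds x, V y = ∑ a, inner ℝ (e a (φ y)) (V y) • e a (φ y) := by
    filter_upwards [hφ.continuousAt.eventually he] with y hy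
    exact (sum_inner_smul_of_orthonormal hy (V y)).symm
  rw [covDerivAlong_congr h, (covDerivAlong_sum hφ Finset.univ (fun a _ ↦
    MDiffAlong.smul (hc a) (MDiffAlong.comp hφ (hd a))) v).2]
  refine Finset.sum_congr rfl fun a _ ↦ ?_
  rw [covDerivAlong_smul (hc a) (MDiffAlong.comp hφ (hd a)), covDerivAlong_comp hφ (hd a),
    ← leviCivita_sum_dir (hd a), sum_inner_smul_of_orthonormal he.self_of_nhds]

/-- `covDerivAlong` uses a trivialization centred at `φ y`, which changes with `y`. One fixed
orthonormal frame near `φ x` gives a formula with visibly regular coefficients. -/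
theorem contMDiffAt_covDerivAlong (hφ : ContMDiff I J ∞ φ) (hV : CMDiffAlong I J 2 φ V x)
    {X : Π x : M, TangentSpace I x} (hX : CMDiffAt 2 (T% X) x) :
    CMDiffAlong I J 1 φ (fun y ↦ covDerivAlong I J φ V y (X y)) x := by
  obtain ⟨e, U, hU, hxU, he⟩ := exists_orthonormal_frame (I := J) (φ x)
  have h12 : (1 : WithTop ℕ∞) + 1 ≤ 2 := by norm_num
  have hφ2 : CMDiffAt 2 φ x := hφ.contMDiffAt.of_le ENat.LEInfty.out
  have hφ1 : CMDiffAt 1 φ x := hφ.contMDiffAt.of_le ENat.LEInfty.out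
  have e2 : ∀ a, CMDiffAt 2 (T% (e a)) (φ x) := fun a ↦ ((he _ hxU).2 a).of_le ENat.LEInfty.out
  have hc : ∀ a, CMDiffAt 2 (fun y ↦ inner ℝ (e a (φ y)) (V y)) x := fun a ↦
    (CMDiffAlong.comp hφ2 (e2 a)).inner hV
  have hb : ∀ b, CMDiffAt 1 (fun y ↦ inner ℝ (e b (φ y)) (mfderiv I J φ y (X y))) x := fun b ↦
    (CMDiffAlong.comp hφ1 ((e2 b).of_le one_le_two)).inner
      (contMDiffAt_mfderiv_apply hφ2 (hX.of_le one_le_two) h12)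
  have key : CMDiffAlong I J 1 φ (fun y ↦ ∑ a, (inner ℝ (e a (φ y)) (V y) •
      ∑ b, inner ℝ (e b (φ y)) (mfderiv I J φ y (X y)) • leviCivita (e a) (φ y) (e b (φ y)) +
        mvfderiv I (fun z ↦ inner ℝ (e a (φ z)) (V z)) y (X y) • e a (φ y))) x := by
    refine CMDiffAlong.sum one_ne_zero _ hφ1 fun a _ ↦ CMDiffAlong.add one_ne_zero
      (.smul one_ne_zero ((hc a).of_le one_le_two) <| .sum one_ne_zero _ hφ1 fun b _ ↦
        .smul one_ne_zero (hb b) ?_)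
      (.smul one_ne_zero (contMDiffAt_mvfderiv_apply (hc a) (hX.of_le one_le_two) h12)
        (.comp hφ1 ((e2 a).of_le one_le_two)))
    exact CMDiffAlong.comp (Y := fun p ↦ leviCivita (e a) p (e b p)) hφ1
      (contMDiffAt_leviCivita (e2 b) (e2 a))
  refine key.congr_of_eventuallyEq ?_
  filter_upwards [eventually_contMDiffAt hV,
    hφ.continuous.continuousAt.eventually_mem (hU.mem_nhds hxU)] with y hy hyU
  have h := covDerivAlong_eq_sum (hφ.contMDiffAt.mdifferentiableAt (by simp))
    (hy.mdifferentiableAt (by simp)) (e := e)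
    (by filter_upwards [hU.mem_nhds hyU] with p hp using (he p hp).1)
    (fun a ↦ ((he _ hyU).2 a).mdifferentiableAt (by simp)) (X y)
  simp only [h]

end CovDerivSmooth

/-- Traces do not depend on the orthonormal basis: expand `b` in `b'` and use ∑ᵢ ⟨b'ⱼ, bᵢ⟩⟨bᵢ, b'ₖ⟩
= δⱼₖ. This allows `onb` to be replaced by a smooth frame for τ and by an eigenbasis for the
divergence. -/
theorem sum_apply_self_eq_of_orthonormalBasis {F F' ι ι' : Type*} [NormedAddCommGroup F]
    [InnerProductSpace ℝ F] [AddCommGroup F'] [Module ℝ F'] [Fintype ι] [Fintype ι']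
    (B : F →ₗ[ℝ] F →ₗ[ℝ] F') (b : OrthonormalBasis ι ℝ F) (b' : OrthonormalBasis ι' ℝ F) :
    ∑ i, B (b i) (b i) = ∑ j, B (b' j) (b' j) := by
  classical
  have h : ∀ i, B (b i) (b i) =
      ∑ j, ∑ k, (inner ℝ (b' j) (b i) * inner ℝ (b i) (b' k)) • B (b' j) (b' k) := fun i ↦ by
    conv_lhs => rw [← b'.sum_repr' (b i)]
    simp only [map_sum, map_smul, LinearMap.sum_apply, LinearMap.smul_apply, Finset.smul_sum,
      smul_smul]
    rw [Finset.sum_comm]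
    refine Finset.sum_congr rfl fun j _ ↦ Finset.sum_congr rfl fun k _ ↦ ?_
    rw [real_inner_comm (b' k) (b i), mul_comm]
  simp only [h]
  rw [Finset.sum_comm]
  refine Finset.sum_congr rfl fun j _ ↦ ?_
  rw [Finset.sum_comm]
  simp only [← Finset.sum_smul, b.sum_inner_mul_inner, b'.inner_eq_ite, ite_smul, one_smul,
      zero_smul]
  simp

/-! ### The Hessian, the second fundamental form and the shape operator. -/

section Hessian

variable {E : Type*} [NormedAddCommGroup E] [NormedSpace ℝ E] [FiniteDimensional ℝ E]
  {G : Type*} [TopologicalSpace G] {I : ModelWithCorners ℝ E G}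
  {M : Type*} [TopologicalSpace M] [ChartedSpace G M] [IsManifold I ∞ M]
  [RiemannianBundle (fun x : M ↦ TangentSpace I x)]
  [IsContMDiffRiemannianBundle I ∞ E (fun x : M ↦ TangentSpace I x)]

/-- `endOfForm` only reads `β` on basis vectors; the bilinear `B` is what extends the identity to
all vectors. -/
theorem inner_endOfForm {x : M} {β : TangentSpace I x → TangentSpace I x → ℝ}
    (B : TangentSpace I x →ₗ[ℝ] TangentSpace I x →ₗ[ℝ] ℝ) (hB : ∀ v w, β v w = B v w)
    (v w : TangentSpace I x) : inner ℝ (endOfForm x β v) w = β v w := by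
  classical
  have h : (innerₗ (TangentSpace I x)).comp (endOfForm x β) = B :=
    LinearMap.ext_basis (onb x).toBasis (onb x).toBasis fun i j ↦ by
      rw [LinearMap.comp_apply, endOfForm, Basis.constr_basis, innerₗ_apply_apply, sum_inner]
      simp [inner_smul_left, (onb x).inner_eq_ite, hB]
  rw [hB, ← h]
  rfl

theorem contMDiffAt_extend {x : M} (v : TangentSpace I x) {n : WithTop ℕ∞} (hn : n ≤ ∞) :
    CMDiffAt n (T% (FiberBundle.extend E v : Π y : M, TangentSpace I y)) x := by
  have h : CMDiffAt ∞ (T% (FiberBundle.extend E v : Π y : M, TangentSpace I y)) x :=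
    FiberBundle.contMDiffAt_extend ..
  exact h.of_le hn

variable {E' : Type*} [NormedAddCommGroup E'] [NormedSpace ℝ E'] [FiniteDimensional ℝ E']
  {G' : Type*} [TopologicalSpace G'] {J : ModelWithCorners ℝ E' G'}
  {N : Type*} [TopologicalSpace N] [ChartedSpace G' N] [IsManifold J ∞ N]

theorem mdiffAlong_mfderiv_apply {φ : M → N} {x : M} {X : Π x : M, TangentSpace I x}
    (hφ : ContMDiff I J ∞ φ) (hX : MDiffAt (T% X) x) :
    MDiffAlong I J φ (fun y ↦ mfderiv I J φ y (X y)) x := by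
  have h : ContMDiffAt I 𝓘(ℝ, E →L[ℝ] E') 1 _ x :=
    (hφ.contMDiffAt (x := x)).mfderiv_const (by norm_cast)
  exact MDifferentiableAt.clm_apply_of_inCoordinates (h.mdifferentiableAt one_ne_zero) hX
    (hφ.contMDiffAt.mdifferentiableAt (by simp))

variable [RiemannianBundle (fun y : N ↦ TangentSpace J y)]
  [IsContMDiffRiemannianBundle J ∞ E' (fun y : N ↦ TangentSpace J y)]

variable {φ : M → N} {x : M}

/-- Both terms contribute the same Leibniz term df(v) dφ(W), with opposite signs. -/
theorem tensorialAt_hessian (hφ : ContMDiff I J ∞ φ) (v : TangentSpace I x) :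
    TensorialAt I E (fun W : Π x : M, TangentSpace I x ↦
      covDerivAlong I J φ (fun y ↦ mfderiv I J φ y (W y)) x v -
        mfderiv I J φ x (leviCivita W x v)) x where
  smul {f W} hf hW := by
    simp only [Pi.smul_apply', map_smul]
    rw [covDerivAlong_smul hf (mdiffAlong_mfderiv_apply hφ hW), leviCivita_smul hf hW, map_add,
      map_smul, map_smul]
    module
  add {W Z} hW hZ := by
    have h := covDerivAlong_add (mdiffAlong_mfderiv_apply hφ hW) (mdiffAlong_mfderiv_apply hφ hZ) v
    rw [leviCivita_add hW hZ, map_add]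
    simp only [Pi.add_apply, map_add]
    refine (congrArg (· - _) h).trans ?_
    module

theorem hessian_eq (hφ : ContMDiff I J ∞ φ) {W : Π x : M, TangentSpace I x}
    (hW : MDiffAt (T% W) x) (v : TangentSpace I x) :
    hessian I J φ x v (W x) = covDerivAlong I J φ (fun y ↦ mfderiv I J φ y (W y)) x v -
        mfderiv I J φ x (leviCivita W x v) :=
  (tensorialAt_hessian hφ v).pointwise (mdifferentiableAt_extend _) hW (by simp)

theorem hessian_add_right (hφ : ContMDiff I J ∞ φ) (v w w' : TangentSpace I x) :
    hessian I J φ x v (w + w') = hessian I J φ x v w + hessian I J φ x v w' := by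
  have h := hessian_eq hφ (mdifferentiableAt_add_section (mdifferentiableAt_extend w)
    (mdifferentiableAt_extend w')) v
  rw [(tensorialAt_hessian hφ v).add (mdifferentiableAt_extend w) (mdifferentiableAt_extend w')]
    at h
  simpa [hessian, covDerivPush] using h

theorem hessian_smul_right (hφ : ContMDiff I J ∞ φ) (c : ℝ) (v w : TangentSpace I x) :
    hessian I J φ x v (c • w) = c • hessian I J φ x v w := by
  have h := hessian_eq hφ (MDifferentiableAt.smul_section (f := fun _ ↦ c)
      mdifferentiableAt_const (mdifferentiableAt_extend w)) v
  rw [(tensorialAt_hessian hφ v).smul mdifferentiableAt_const (mdifferentiableAt_extend w)] at h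
  simpa [hessian, covDerivPush] using h

theorem hessian_add_left (v v' w : TangentSpace I x) :
    hessian I J φ x (v + v') w = hessian I J φ x v w + hessian I J φ x v' w := by
  simp only [hessian, covDerivPush]
  rw [covDerivAlong_add_dir, leviCivita_add_dir (mdifferentiableAt_extend w), map_add]
  abel

theorem hessian_smul_left (c : ℝ) (v w : TangentSpace I x) :
    hessian I J φ x (c • v) w = c • hessian I J φ x v w := by
  simp only [hessian, covDerivPush]
  rw [covDerivAlong_smul_dir, leviCivita_smul_dir (mdifferentiableAt_extend w), map_smul, smul_sub]

/-- The Hessian `∇dφ` at a point as a bilinear map. -/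
noncomputable def hessianₗ (hφ : ContMDiff I J ∞ φ) (x : M) :
    TangentSpace I x →ₗ[ℝ] TangentSpace I x →ₗ[ℝ] TangentSpace J (φ x) :=
  LinearMap.mk₂ ℝ (hessian I J φ x) hessian_add_left hessian_smul_left (hessian_add_right hφ)
    (hessian_smul_right hφ)

/-- Torsion-freeness, for chart-constant and hence commuting fields. -/
theorem leviCivita_extend_comm (v w : TangentSpace I x) :
    leviCivita (FiberBundle.extend E v) x w = leviCivita (FiberBundle.extend E w) x v := by
  have h := leviCivita_sub_leviCivita (mdifferentiableAt_extend v) (mdifferentiableAt_extend w)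
  rw [mlieBracket_extend, sub_eq_zero] at h
  simpa using h.symm

/-- In coordinates there are two parts: the second derivative of φ, symmetric as φ is smooth, and
the connection term of the target, symmetric by torsion-freeness. -/
theorem covDerivPush_comm [I.Boundaryless] (hφ : ContMDiff I J ∞ φ) (v w : TangentSpace I x) :
    covDerivPush I J φ x v w = covDerivPush I J φ x w v := by
  have hψ : CMDiffAt 2 (fun y ↦ extChartAt J (φ x) (φ y)) x :=
    ContMDiffAt.comp (I' := J) x contMDiffAt_extChartAt (hφ.contMDiffAt.of_le ENat.LEInfty.out)
  have e : ∀ w : TangentSpace I x, (fun y ↦ (trivializationAt E' (TangentSpace J : N → Type _) (φ x)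
      (TotalSpace.mk' E' (φ y) (mfderiv I J φ y (FiberBundle.extend E w y)))).2) =ᶠ[nhds x]
      fun y ↦ mvfderiv I (fun y ↦ extChartAt J (φ x) (φ y)) y (FiberBundle.extend E w y) :=
    fun w ↦ by
    filter_upwards [hφ.continuous.continuousAt.eventually_mem
      ((chartAt G' (φ x)).open_source.mem_nhds (mem_chart_source G' (φ x)))] with y hy
    rw [mvfderiv_comp_apply (g := extChartAt J (φ x)) (mdifferentiableAt_extChartAt hy)
      (hφ.contMDiffAt.mdifferentiableAt (by simp))]
    exact (mfderiv_extChartAt_apply hy _).symm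
  simp only [covDerivPush, covDerivAlong, FiberBundle.extend_apply_self]
  rw [mvfderiv_congr (e w), mvfderiv_congr (e v), mvfderiv_mvfderiv_extend_comm hψ,
    leviCivita_extend_comm]

theorem hessian_comm [I.Boundaryless] (hφ : ContMDiff I J ∞ φ) (v w : TangentSpace I x) :
    hessian I J φ x v w = hessian I J φ x w v := by
  rw [hessian, hessian, covDerivPush_comm hφ, leviCivita_extend_comm]

/-- The Hessian of a Riemannian immersion is normal. -/
theorem inner_hessian_mfderiv [I.Boundaryless] (hφ : IsRiemannianImmersion I J φ)
    (v w z : TangentSpace I x) : inner ℝ (hessian I J φ x v w) (mfderiv I J φ x z) = 0 := by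
  have hs := hφ.contMDiff
  -- The derivative of ⟨dφ W, dφ Z⟩ = ⟨W, Z⟩ computed with both connections.
  have skew : ∀ v w z : TangentSpace I x, inner ℝ (hessian I J φ x v w) (mfderiv I J φ x z) +
      inner ℝ (hessian I J φ x v z) (mfderiv I J φ x w) = 0 := fun v w z ↦ by
    have hw := mdifferentiableAt_extend w
    have hz := mdifferentiableAt_extend z
    have h1 := mvfderiv_inner_along (mdiffAlong_mfderiv_apply hs hw)
        (mdiffAlong_mfderiv_apply hs hz) v
    have h2 := mvfderiv_inner hw hz v
    simp only [hφ.inner_mfderiv] at h1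
    rw [h1] at h2
    simp only [FiberBundle.extend_apply_self] at h2
    simp only [hessian, covDerivPush, inner_sub_left, hφ.inner_mfderiv]
    rw [real_inner_comm (mfderiv I J φ x w), real_inner_comm w]
    linarith
  -- A trilinear form symmetric in its first two slots and skew in its last two vanishes; three
  -- instances of `skew` suffice.
  have h1 := skew v w z
  have h2 := skew z v w
  have h3 := skew w z v
  rw [hessian_comm hs z v] at h2
  rw [hessian_comm hs w z, hessian_comm hs w v] at h3
  linarith

/-- The part removed from ∇_v(dφ W) to form the Hessian is tangent, and the remainder is normal. -/
theorem secondFundamentalForm_eq_hessian [I.Boundaryless] (hφ : IsRiemannianImmersion I J φ)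
    (v w : TangentSpace I x) : secondFundamentalForm I J φ x v w = hessian I J φ x v w := by
  have h : covDerivPush I J φ x v w = hessian I J φ x v w +
      mfderiv I J φ x (leviCivita (FiberBundle.extend E w) x v) := by
    rw [hessian, sub_add_cancel]
  rw [secondFundamentalForm, h, map_add, Submodule.starProjection_eq_self_iff.2,
    (Submodule.starProjection_apply_eq_zero_iff _).2, add_zero]
  · exact Submodule.le_orthogonal_orthogonal _ ⟨_, rfl⟩
  · rw [normalSpace, Submodule.mem_orthogonal']
    rintro _ ⟨z, rfl⟩
    exact inner_hessian_mfderiv hφ v w z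

theorem meanCurvature_eq_tension [I.Boundaryless] (hφ : IsRiemannianImmersion I J φ) :
    meanCurvature I J φ x = (finrank ℝ (TangentSpace I x) : ℝ)⁻¹ • tension I J φ x := by
  simp only [meanCurvature, secondFundamentalForm_eq_hessian hφ, tension]

theorem inner_shapeOperator [I.Boundaryless] (hφ : IsRiemannianImmersion I J φ)
    (v w : TangentSpace I x) : inner ℝ (shapeOperator I J φ x v) w =
      (finrank ℝ (TangentSpace I x) : ℝ)⁻¹ * inner ℝ (hessian I J φ x v w) (tension I J φ x) := by
  rw [shapeOperator, inner_endOfForm ((hessianₗ hφ.contMDiff x).compr₂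
    ((innerₗ _).flip (meanCurvature I J φ x)))]
  · rw [secondFundamentalForm_eq_hessian hφ, meanCurvature_eq_tension hφ, inner_smul_right]
  · intro v w
    rw [secondFundamentalForm_eq_hessian hφ]
    rfl

theorem tension_eq_sum (hφ : ContMDiff I J ∞ φ) {ι : Type*} [Fintype ι]
    (b : OrthonormalBasis ι ℝ (TangentSpace I x)) :
    tension I J φ x = ∑ i, hessian I J φ x (b i) (b i) :=
  sum_apply_self_eq_of_orthonormalBasis (hessianₗ hφ x) (onb x) b

theorem contMDiffAt_hessian (hφ : ContMDiff I J ∞ φ) {X Y : Π x : M, TangentSpace I x}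
    (hX : CMDiffAt 2 (T% X) x) (hY : CMDiffAt 2 (T% Y) x) :
    CMDiffAlong I J 1 φ (fun y ↦ hessian I J φ y (X y) (Y y)) x := by
  have h1 := contMDiffAt_covDerivAlong hφ (contMDiffAt_mfderiv_apply
    (hφ.contMDiffAt (x := x)) hY (by norm_cast)) hX
  have h2 := contMDiffAt_mfderiv_apply (hφ.contMDiffAt (x := x)) (contMDiffAt_leviCivita hX hY)
    (by norm_cast)
  have h3 := h1.add one_ne_zero (.smul one_ne_zero (contMDiffAt_const (c := (-1 : ℝ))) h2)
  refine h3.congr_of_eventuallyEq ?_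
  filter_upwards [eventually_contMDiffAt (φ := id) hY] with y hy
  rw [hessian_eq hφ (hy.mdifferentiableAt (by simp))]
  simp [sub_eq_add_neg]

/-- An orthonormal frame gives orthonormal bases. -/
theorem exists_orthonormalBasis_eq {e : Fin (finrank ℝ E) → TangentSpace I x}
    (he : Orthonormal ℝ e) :
    ∃ b : OrthonormalBasis (Fin (finrank ℝ E)) ℝ (TangentSpace I x), ∀ i, b i = e i := by
  have hc : Fintype.card (Fin (finrank ℝ E)) = finrank ℝ (TangentSpace I x) := by
    simp; rfl
  exact ⟨OrthonormalBasis.mk he (he.linearIndependent.span_eq_top_of_card_eq_finrank' hc).ge,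
    fun i ↦ by simp⟩

/-- C¹ regularity is enough below: τ and A_H are differentiated only once. -/
theorem contMDiffAt_tension (hφ : ContMDiff I J ∞ φ) :
    CMDiffAlong I J 1 φ (tension I J φ) x := by
  obtain ⟨e, U, hU, hxU, he⟩ := exists_orthonormal_frame (I := I) x
  have e2 : ∀ a, CMDiffAt 2 (T% (e a)) x := fun a ↦ ((he _ hxU).2 a).of_le ENat.LEInfty.out
  refine (CMDiffAlong.sum one_ne_zero Finset.univ (hφ.contMDiffAt.of_le ENat.LEInfty.out)
    fun a _ ↦ contMDiffAt_hessian hφ (e2 a) (e2 a)).congr_of_eventuallyEq ?_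
  filter_upwards [hU.mem_nhds hxU] with y hy
  obtain ⟨b, hb⟩ := exists_orthonormalBasis_eq (he y hy).1
  rw [tension_eq_sum hφ b]
  simp only [hb]

theorem contMDiffAt_inner_shapeOperator [I.Boundaryless] (hφ : IsRiemannianImmersion I J φ)
    {X Y : Π x : M, TangentSpace I x}
    (hX : CMDiffAt 2 (T% X) x) (hY : CMDiffAt 2 (T% Y) x) :
    CMDiffAt 1 (fun y ↦ inner ℝ (shapeOperator I J φ y (X y)) (Y y)) x := by
  simp only [inner_shapeOperator hφ]
  exact (contMDiffAt_const (c := (finrank ℝ E : ℝ)⁻¹)).mul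
      ((contMDiffAt_hessian hφ.contMDiff hX hY).inner
    (contMDiffAt_tension hφ.contMDiff))

theorem contMDiffAt_shapeOperator [I.Boundaryless] (hφ : IsRiemannianImmersion I J φ)
    {X : Π x : M, TangentSpace I x} (hX : CMDiffAt 2 (T% X) x) :
    CMDiffAt 1 (T% (fun y ↦ shapeOperator I J φ y (X y))) x := by
  obtain ⟨e, U, hU, hxU, he⟩ := exists_orthonormal_frame (I := I) x
  have e2 : ∀ a, CMDiffAt 2 (T% (e a)) x := fun a ↦ ((he _ hxU).2 a).of_le ENat.LEInfty.out
  have key : CMDiffAt 1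
      (T% (fun y ↦ ∑ i, ((fun y ↦ inner ℝ (e i y) (shapeOperator I J φ y (X y))) • e i) y)) x :=
    ContMDiffAt.sum_section fun i _ ↦ ContMDiffAt.smul_section
      ((contMDiffAt_inner_shapeOperator hφ hX (e2 i)).congr_of_eventuallyEq
        (.of_forall fun y ↦ real_inner_comm _ _)) ((e2 i).of_le one_le_two)
  refine key.congr_of_eventuallyEq ?_
  filter_upwards [hU.mem_nhds hxU] with y hy
  have h := sum_inner_smul_of_orthonormal (he y hy).1 (shapeOperator I J φ y (X y))
  simp only [Pi.smul_apply', h]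

end Hessian

/-! ### Symmetric endomorphism fields with constant eigenvalues. -/

section Endomorphisms

variable {E : Type*} [NormedAddCommGroup E] [NormedSpace ℝ E] [FiniteDimensional ℝ E]
  {G : Type*} [TopologicalSpace G] {I : ModelWithCorners ℝ E G}
  {M : Type*} [TopologicalSpace M] [ChartedSpace G M] [IsManifold I ∞ M]
  [RiemannianBundle (fun x : M ↦ TangentSpace I x)]
  [IsContMDiffRiemannianBundle I ∞ E (fun x : M ↦ TangentSpace I x)]

/-- Differentiability of a field of endomorphisms of the tangent spaces. -/
def MDiffEnd (T : Π x : M, TangentSpace I x →ₗ[ℝ] TangentSpace I x) : Prop :=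
  ∀ (x : M) (w : TangentSpace I x),
    MDiffAt (T% (fun y ↦ T y (FiberBundle.extend E w y))) x

variable {T : Π x : M, TangentSpace I x →ₗ[ℝ] TangentSpace I x} {x : M}

theorem covDerivEnd_add_left (hT : MDiffEnd T) (v v' w : TangentSpace I x) :
    covDerivEnd T x (v + v') w = covDerivEnd T x v w + covDerivEnd T x v' w := by
  simp only [covDerivEnd]
  rw [leviCivita_add_dir (hT x w), leviCivita_add_dir (mdifferentiableAt_extend w), map_add]
  abel

theorem covDerivEnd_smul_left (hT : MDiffEnd T) (c : ℝ) (v w : TangentSpace I x) :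
    covDerivEnd T x (c • v) w = c • covDerivEnd T x v w := by
  simp only [covDerivEnd]
  rw [leviCivita_smul_dir (hT x w), leviCivita_smul_dir (mdifferentiableAt_extend w), map_smul,
    smul_sub]

theorem covDerivEnd_add_right (hT : MDiffEnd T) (v w w' : TangentSpace I x) :
    covDerivEnd T x v (w + w') = covDerivEnd T x v w + covDerivEnd T x v w' := by
  have h : ∀ᶠ y in nhds x, T y (FiberBundle.extend E (w + w') y) =
      ((fun y : M ↦ T y (FiberBundle.extend E w y)) + fun y : M ↦ T y (FiberBundle.extend E w' y))
        y := by
    filter_upwards [eventually_extend_add w w'] with y hy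
    rw [hy]
    simp
  simp only [covDerivEnd]
  rw [leviCivita_congr (hT x _) h, leviCivita_add (hT x w) (hT x w'), leviCivita_extend_add,
      map_add]
  abel

theorem covDerivEnd_smul_right (hT : MDiffEnd T) (c : ℝ) (v w : TangentSpace I x) :
    covDerivEnd T x v (c • w) = c • covDerivEnd T x v w := by
  have h : ∀ᶠ y in nhds x, T y (FiberBundle.extend E (c • w) y) =
      ((fun _ : M ↦ c) • fun y : M ↦ T y (FiberBundle.extend E w y)) y := by
    filter_upwards [eventually_extend_smul c w] with y hy
    rw [hy]
    simp
  simp only [covDerivEnd]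
  rw [leviCivita_congr (hT x _) h, leviCivita_smul mdifferentiableAt_const (hT x w),
    leviCivita_extend_smul, map_smul, mvfderiv_const]
  simp [smul_sub]

/-- `∇T` at a point as a bilinear map. -/
noncomputable def covDerivEndₗ (hT : MDiffEnd T) (x : M) :
    TangentSpace I x →ₗ[ℝ] TangentSpace I x →ₗ[ℝ] TangentSpace I x :=
  LinearMap.mk₂ ℝ (covDerivEnd T x) (covDerivEnd_add_left hT) (covDerivEnd_smul_left hT)
    (covDerivEnd_add_right hT) (covDerivEnd_smul_right hT)

theorem divergence_eq_sum (hT : MDiffEnd T) {ι : Type*} [Fintype ι]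
    (b : OrthonormalBasis ι ℝ (TangentSpace I x)) :
    divergence T x = ∑ i, covDerivEnd T x (b i) (b i) :=
  sum_apply_self_eq_of_orthonormalBasis (covDerivEndₗ hT x) (onb x) b

theorem covDerivEnd_smul_id_add_smul (hT : MDiffEnd T) (a b : ℝ) (v w : TangentSpace I x) :
    covDerivEnd (fun y ↦ a • LinearMap.id + b • T y) x v w = b • covDerivEnd T x v w := by
  have hw := mdifferentiableAt_extend w
  have e : (fun y : M ↦ (a • LinearMap.id + b • T y : TangentSpace I y →ₗ[ℝ] TangentSpace I y)
      (FiberBundle.extend E w y)) =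
      (fun _ : M ↦ a) • FiberBundle.extend E w +
        (fun _ : M ↦ b) • fun y : M ↦ T y (FiberBundle.extend E w y) := by
    ext y
    simp
  simp only [covDerivEnd]
  rw [e, leviCivita_add (MDifferentiableAt.smul_section mdifferentiableAt_const hw)
      (MDifferentiableAt.smul_section mdifferentiableAt_const (hT x w)),
    leviCivita_smul mdifferentiableAt_const hw, leviCivita_smul mdifferentiableAt_const (hT x w),
    mvfderiv_const, mvfderiv_const]
  simp [smul_sub]

theorem divergence_smul_id_add_smul (hT : MDiffEnd T) (a b : ℝ) :
    divergence (fun y ↦ a • LinearMap.id + b • T y) x = b • divergence T x := by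
  simp only [divergence, covDerivEnd_smul_id_add_smul hT, Finset.smul_sum]

/-- Differentiate ⟨TW, Z⟩ = ⟨W, TZ⟩. -/
theorem inner_covDerivEnd_comm (hT : MDiffEnd T) (hs : ∀ y, (T y).IsSymmetric)
    (v w z : TangentSpace I x) :
    inner ℝ (covDerivEnd T x v w) z = inner ℝ (covDerivEnd T x v z) w := by
  have h1 := mvfderiv_inner (hT x w) (mdifferentiableAt_extend z) v
  have h2 := mvfderiv_inner (mdifferentiableAt_extend w) (hT x z) v
  have e : (fun y ↦ inner ℝ (T y (FiberBundle.extend E w y)) (FiberBundle.extend E z y)) =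
      fun y ↦ inner ℝ (FiberBundle.extend E w y) (T y (FiberBundle.extend E z y)) :=
    funext fun y ↦ hs y _ _
  rw [e, h2] at h1
  simp only [FiberBundle.extend_apply_self] at h1
  simp only [covDerivEnd, inner_sub_left]
  rw [hs x, hs x, real_inner_comm w, real_inner_comm (T x w)]
  linarith

/-- Let the symmetric field `T` satisfy `T² = t T - d` with constant `t`, `d` and nonzero
discriminant. Then `∇T` is off-diagonal with respect to every eigenvector of `T`. -/
theorem inner_covDerivEnd_self (hT : MDiffEnd T) (hs : ∀ y, (T y).IsSymmetric) {t d : ℝ}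
    (hq : ∀ (y : M) (w : TangentSpace I y), T y (T y w) = t • T y w - d • w)
    (ht : t ^ 2 - 4 * d ≠ 0) {μ : ℝ} {e : TangentSpace I x} (he : T x e = μ • e)
    (v : TangentSpace I x) : inner ℝ (covDerivEnd T x v e) e = 0 := by
  rcases eq_or_ne e 0 with rfl | he0
  · simp
  have hμ : μ * μ = t * μ - d := by
    have h := hq x e
    simp only [he, map_smul, smul_smul, ← sub_smul] at h
    exact smul_left_injective ℝ he0 h
  have hW := mdifferentiableAt_extend e
  have hTW := hT x e
  have h1 := mvfderiv_inner hTW hTW v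
  have h2 := mvfderiv_inner hTW hW v
  have h3 := mvfderiv_inner hW hW v
  -- The relation T² = tT - d paired with W, where W is any extension of `e`. Only at `x` does it
  -- have to be an eigenvector.
  have e1 : (fun y ↦ inner ℝ (T y (FiberBundle.extend E e y)) (T y (FiberBundle.extend E e y))) =
      (fun _ ↦ t) * (fun y ↦ inner ℝ (T y (FiberBundle.extend E e y)) (FiberBundle.extend E e y)) +
      (fun _ ↦ -d) * fun y ↦ inner ℝ (FiberBundle.extend E e y) (FiberBundle.extend E e y) := by
    ext y
    have h := hs y (T y (FiberBundle.extend E e y)) (FiberBundle.extend E e y)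
    rw [← h, hq, inner_sub_left, inner_smul_left, inner_smul_left]
    simp
    ring
  have m2 := mdifferentiableAt_inner hTW hW
  have m3 := mdifferentiableAt_inner hW hW
  rw [e1, mvfderiv_add (mdifferentiableAt_const.mul m2) (mdifferentiableAt_const.mul m3),
    mvfderiv_mul mdifferentiableAt_const m2, mvfderiv_mul mdifferentiableAt_const m3] at h1
  simp [mvfderiv_const, h2, h3, he, inner_smul_left, inner_smul_right,
    -inner_self_eq_norm_sq_to_K] at h1
  rw [covDerivEnd, inner_sub_left, hs x, he, inner_smul_right]
  simp only [real_inner_comm _ e] at h1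
  -- Since μ is a root of X² - tX + d, (2μ - t)² equals the discriminant.
  have hne : 2 * μ - t ≠ 0 := fun h ↦ ht (by linear_combination (2 * μ - t) * h - 4 * hμ)
  refine (mul_eq_zero.1 (?_ : (2 * μ - t) * _ = 0)).resolve_left hne
  linear_combination
    -h1 - 2 * inner ℝ (leviCivita (FiberBundle.extend E e) x v) e * hμ

/-- A divergence free symmetric field of endomorphisms with constant eigenvalues on a surface is
parallel. -/
theorem isParallel_of_divergence_eq_zero (hE : finrank ℝ E = 2) (hT : MDiffEnd T)
    (hs : ∀ y, (T y).IsSymmetric) {c₀ c₁ : ℝ}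
    (hq : ∀ (y : M) (w : TangentSpace I y), T y (T y w) = (c₀ + c₁) • T y w - (c₀ * c₁) • w)
    (hdiv : ∀ y, divergence T y = 0) : IsParallel T := by
  intro x v w
  rcases eq_or_ne c₀ c₁ with rfl | hc
  · have hid : ∀ (y : M) (w : TangentSpace I y), T y w = c₀ • w := fun y w ↦ by
      -- Here (T - c₀)² = 0, so by symmetry |(T - c₀)w|² = ⟨(T - c₀)²w, w⟩ = 0.
      rw [← sub_eq_zero, ← inner_self_eq_zero (𝕜 := ℝ)]
      have h := hs y (T y w) w
      rw [hq, inner_sub_left, inner_smul_left, inner_smul_left] at h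
      simp only [inner_sub_left, inner_sub_right, inner_smul_left, inner_smul_right, ← h,
        real_inner_comm (T y w) w]
      simp
      ring
    have e : (fun y ↦ T y (FiberBundle.extend E w y)) =
        (fun _ : M ↦ c₀) • FiberBundle.extend E w := by
      ext y
      simp [hid]
    rw [covDerivEnd, e, leviCivita_smul mdifferentiableAt_const (mdifferentiableAt_extend w),
      mvfderiv_const, hid]
    simp
  · have ht : (c₀ + c₁) ^ 2 - 4 * (c₀ * c₁) ≠ 0 := by
      have : (c₀ - c₁) ^ 2 ≠ 0 := pow_ne_zero _ (sub_ne_zero.2 hc)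
      intro h
      exact this (by linear_combination h)
    have h2 : finrank ℝ (TangentSpace I x) = 2 := hE
    let b := (hs x).eigenvectorBasis h2
    have hb : ∀ i, T x (b i) = ((hs x).eigenvalues h2 i : ℝ) • b i := fun i ↦
      (hs x).apply_eigenvectorBasis h2 i
    have diag : ∀ v i, inner ℝ (covDerivEnd T x v (b i)) (b i) = 0 := fun v i ↦
      inner_covDerivEnd_self hT hs hq ht (hb i) v
    have hsum := hdiv x
    -- With the trace taken in the eigenbasis at `x`, pairing with one basis vector leaves a single
    -- term, the other being diagonal.
    rw [divergence_eq_sum hT b, Fin.sum_univ_two] at hsum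
    have h01 : inner ℝ (covDerivEnd T x (b 0) (b 0)) (b 1) = 0 := by
      have h := congrArg (fun u ↦ inner ℝ u (b 1)) hsum
      simpa only [inner_add_left, diag, add_zero, inner_zero_left] using h
    have h10 : inner ℝ (covDerivEnd T x (b 1) (b 1)) (b 0) = 0 := by
      have h := congrArg (fun u ↦ inner ℝ u (b 0)) hsum
      simpa only [inner_add_left, diag, zero_add, inner_zero_left] using h
    -- Of the eight components, four are diagonal, two are killed by the divergence, and symmetry of
    -- ∇T gives the last two.
    have hall : ∀ i j k, inner ℝ (covDerivEnd T x (b i) (b j)) (b k) = 0 := by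
      have h01' := inner_covDerivEnd_comm hT hs (b 0) (b 0) (b 1)
      have h10' := inner_covDerivEnd_comm hT hs (b 1) (b 1) (b 0)
      rw [h01] at h01'
      rw [h10] at h10'
      simp only [Fin.forall_fin_two]
      exact ⟨⟨⟨diag _ _, h01⟩, h01'.symm, diag _ _⟩, ⟨diag _ _, h10'.symm⟩, h10, diag _ _⟩
    have h0 : covDerivEndₗ hT x = 0 := LinearMap.ext_basis b.toBasis b.toBasis fun i j ↦ by
      rw [b.coe_toBasis, ← b.sum_repr' (covDerivEndₗ hT x (b i) (b j))]
      refine Finset.sum_eq_zero fun k _ ↦ ?_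
      have h : inner ℝ (b k) (covDerivEndₗ hT x (b i) (b j)) = 0 :=
        (real_inner_comm _ _).trans (hall i j k)
      rw [h, zero_smul]
    exact DFunLike.congr_fun (DFunLike.congr_fun h0 v) w

end Endomorphisms

/-! ### The stress-bienergy tensor and the divergence of the shape operator. -/

section Biconservative

variable {E : Type*} [NormedAddCommGroup E] [NormedSpace ℝ E] [FiniteDimensional ℝ E]
  {G : Type*} [TopologicalSpace G] {I : ModelWithCorners ℝ E G} [I.Boundaryless]
  {M : Type*} [TopologicalSpace M] [ChartedSpace G M] [IsManifold I ∞ M]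
  [RiemannianBundle (fun x : M ↦ TangentSpace I x)]
  [IsContMDiffRiemannianBundle I ∞ E (fun x : M ↦ TangentSpace I x)]
  {E' : Type*} [NormedAddCommGroup E'] [NormedSpace ℝ E'] [FiniteDimensional ℝ E']
  {G' : Type*} [TopologicalSpace G'] {J : ModelWithCorners ℝ E' G'}
  {N : Type*} [TopologicalSpace N] [ChartedSpace G' N] [IsManifold J ∞ N]
  [RiemannianBundle (fun y : N ↦ TangentSpace J y)]
  [IsContMDiffRiemannianBundle J ∞ E' (fun y : N ↦ TangentSpace J y)]
  {φ : M → N} {x : M}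

theorem inner_mfderiv_tension (hφ : IsRiemannianImmersion I J φ) (v : TangentSpace I x) :
    inner ℝ (mfderiv I J φ x v) (tension I J φ x) = 0 := by
  rw [real_inner_comm, tension, sum_inner]
  exact Finset.sum_eq_zero fun i _ ↦ inner_hessian_mfderiv hφ _ _ _

/-- Differentiate ⟨dφ V, τ⟩ = 0; the tangent part of ∇_w(dφ V) is orthogonal to τ, leaving the
Hessian. -/
theorem inner_mfderiv_covDerivAlong_tension (hφ : IsRiemannianImmersion I J φ)
    (v w : TangentSpace I x) :
    inner ℝ (mfderiv I J φ x v) (covDerivAlong I J φ (tension I J φ) x w) =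
      -inner ℝ (hessian I J φ x w v) (tension I J φ x) := by
  have hτ : MDiffAlong I J φ (tension I J φ) x :=
    (contMDiffAt_tension hφ.contMDiff).mdifferentiableAt one_ne_zero
  have h := mvfderiv_inner_along
    (mdiffAlong_mfderiv_apply hφ.contMDiff (mdifferentiableAt_extend v)) hτ w
  simp only [inner_mfderiv_tension hφ, mvfderiv_const, zero_apply,
    FiberBundle.extend_apply_self] at h
  rw [hessian, inner_sub_left, inner_mfderiv_tension hφ, covDerivPush]
  linarith

theorem isSymmetric_shapeOperator (hφ : IsRiemannianImmersion I J φ) :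
    (shapeOperator I J φ x).IsSymmetric := fun v w ↦ by
  rw [inner_shapeOperator hφ, real_inner_comm (shapeOperator I J φ x w), inner_shapeOperator hφ,
    hessian_comm hφ.contMDiff]

theorem mdiffEnd_shapeOperator (hφ : IsRiemannianImmersion I J φ) :
    MDiffEnd (shapeOperator I J φ) := fun _ w ↦
  (contMDiffAt_shapeOperator hφ (contMDiffAt_extend w ENat.LEInfty.out)).mdifferentiableAt
    one_ne_zero

/-- Sum ⟨∇dφ(eᵢ, eᵢ), τ⟩ / m. This converts constant eigenvalues into constant |τ|². -/
theorem trace_shapeOperator (hφ : IsRiemannianImmersion I J φ) :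
    LinearMap.trace ℝ _ (shapeOperator I J φ x) =
      (finrank ℝ (TangentSpace I x) : ℝ)⁻¹ * ‖tension I J φ x‖ ^ 2 := by
  rw [LinearMap.trace_eq_sum_inner _ (onb x), ← real_inner_self_eq_norm_sq]
  conv_rhs => rw [tension, sum_inner, Finset.mul_sum]
  refine Finset.sum_congr rfl fun i _ ↦ ?_
  rw [real_inner_comm, inner_shapeOperator hφ, tension]

/-- The stress-bienergy tensor of a Riemannian immersion is `-½ |τ|² Id + 2 m A_H`. -/
theorem stressBienergy_eq (hφ : IsRiemannianImmersion I J φ) :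
    stressBienergy I J φ x = (-(1 / 2) * ‖tension I J φ x‖ ^ 2) • LinearMap.id +
      (2 * (finrank ℝ (TangentSpace I x) : ℝ)) • shapeOperator I J φ x := by
  -- In dimension zero the factor m⁻¹ in `inner_shapeOperator` cannot be cancelled, but all
  -- endomorphisms agree.
  rcases Nat.eq_zero_or_pos (finrank ℝ (TangentSpace I x)) with h0 | h0
  · have := finrank_zero_iff.1 h0
    exact LinearMap.ext fun v ↦ Subsingleton.elim _ _
  have hm : (finrank ℝ (TangentSpace I x) : ℝ) ≠ 0 := by positivity
  refine LinearMap.ext fun v ↦ ext_inner_right ℝ fun w ↦ ?_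
  -- Thus ⟨dφ, ∇τ⟩ = -|τ|², which turns the coefficient ½ of |τ|² into -½.
  have hsum : ∑ i, inner ℝ (mfderiv I J φ x (onb x i))
      (covDerivAlong I J φ (tension I J φ) x (onb x i)) = -‖tension I J φ x‖ ^ 2 := by
    simp only [inner_mfderiv_covDerivAlong_tension hφ, Finset.sum_neg_distrib, ← sum_inner]
    rw [← real_inner_self_eq_norm_sq]
    rfl
  have hβ : ∀ v w : TangentSpace I x,
      1 / 2 * ‖tension I J φ x‖ ^ 2 * inner ℝ v w
      + (∑ i, inner ℝ (mfderiv I J φ x (onb x i))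
          (covDerivAlong I J φ (tension I J φ) x (onb x i))) * inner ℝ v w
      - inner ℝ (mfderiv I J φ x v) (covDerivAlong I J φ (tension I J φ) x w)
      - inner ℝ (mfderiv I J φ x w) (covDerivAlong I J φ (tension I J φ) x v) =
      (innerₗ (TangentSpace I x)).comp ((-(1 / 2) * ‖tension I J φ x‖ ^ 2) • LinearMap.id +
        (2 * (finrank ℝ (TangentSpace I x) : ℝ)) • shapeOperator I J φ x) v w := fun v w ↦ by
    rw [hsum, inner_mfderiv_covDerivAlong_tension hφ, inner_mfderiv_covDerivAlong_tension hφ,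
      hessian_comm hφ.contMDiff w v]
    simp only [LinearMap.comp_apply, innerₗ_apply_apply, LinearMap.add_apply, LinearMap.smul_apply,
      LinearMap.id_apply, inner_add_left, inner_smul_left, inner_shapeOperator hφ, conj_trivial]
    field_simp
    ring
  rw [stressBienergy, inner_endOfForm _ hβ, hβ]
  rfl

/-- A biconservative immersion whose mean curvature vector field has constant length has a
divergence free shape operator. -/
theorem divergence_shapeOperator_eq_zero (hφ : IsRiemannianImmersion I J φ) (hE : 0 < finrank ℝ E)
    (hbi : IsBiconservative I J φ) {c : ℝ} (hc : ∀ x, ‖tension I J φ x‖ ^ 2 = c) (x : M) :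
    divergence (shapeOperator I J φ) x = 0 := by
  have h := hbi x
  have e : stressBienergy I J φ = fun y ↦ (-(1 / 2) * c) • LinearMap.id +
      (2 * (finrank ℝ E : ℝ)) • shapeOperator I J φ y := by
    ext1 y
    rw [stressBienergy_eq hφ, hc]
    rfl
  rw [e, divergence_smul_id_add_smul (mdiffEnd_shapeOperator hφ)] at h
  exact (smul_eq_zero.1 h).resolve_left (by positivity)

theorem trace_eq_add_of_charpoly_eq {F : Type*} [AddCommGroup F] [Module ℝ F]
    [FiniteDimensional ℝ F] {T : F →ₗ[ℝ] F} {c₀ c₁ : ℝ}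
    (h : T.charpoly = (Polynomial.X - Polynomial.C c₀) * (Polynomial.X - Polynomial.C c₁)) :
    LinearMap.trace ℝ F T = c₀ + c₁ := by
  have hs : T.charpoly.Splits := by
    rw [h]
    exact (Polynomial.Splits.X_sub_C _).mul (Polynomial.Splits.X_sub_C _)
  rw [Module.End.trace_eq_sum_roots_charpoly_of_splits hs, h, Polynomial.roots_mul
    (mul_ne_zero (Polynomial.X_sub_C_ne_zero _) (Polynomial.X_sub_C_ne_zero _))]
  simp

/-- Cayley-Hamilton, giving the quadratic relation with constant coefficients. -/
theorem apply_apply_of_charpoly_eq {F : Type*} [AddCommGroup F] [Module ℝ F]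
    [FiniteDimensional ℝ F] {T : F →ₗ[ℝ] F} {c₀ c₁ : ℝ}
    (h : T.charpoly = (Polynomial.X - Polynomial.C c₀) * (Polynomial.X - Polynomial.C c₁)) (w : F) :
    T (T w) = (c₀ + c₁) • T w - (c₀ * c₁) • w := by
  have h1 := T.aeval_self_charpoly
  rw [h] at h1
  have h2 := DFunLike.congr_fun h1 w
  simp [Module.algebraMap_end_apply] at h2
  rw [← sub_eq_zero, ← h2]
  module

end Biconservative

end Riem

theorem mainTheorem6 {n : ℕ}
    {M : Type*} [TopologicalSpace M] [ChartedSpace (EuclideanSpace ℝ (Fin 2)) M]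
    [IsManifold (𝓡 2) ∞ M]
    [RiemannianBundle (fun x : M ↦ TangentSpace (𝓡 2) x)]
    [IsContMDiffRiemannianBundle (𝓡 2) ∞ (EuclideanSpace ℝ (Fin 2))
      (fun x : M ↦ TangentSpace (𝓡 2) x)]
    {N : Type*} [TopologicalSpace N] [ChartedSpace (EuclideanSpace ℝ (Fin n)) N]
    [IsManifold (𝓡 n) ∞ N]
    [RiemannianBundle (fun y : N ↦ TangentSpace (𝓡 n) y)]
    [IsContMDiffRiemannianBundle (𝓡 n) ∞ (EuclideanSpace ℝ (Fin n))
      (fun y : N ↦ TangentSpace (𝓡 n) y)]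
    (φ : M → N) (hφ : Riem.IsRiemannianImmersion (𝓡 2) (𝓡 n) φ)
    (hbi : Riem.IsBiconservative (𝓡 2) (𝓡 n) φ)
    (lam : Fin 2 → M → ℝ) (hlam : Riem.IsPrincipalCurvatures (𝓡 2) (𝓡 n) φ lam)
    (hconst : ∀ i, ∃ c : ℝ, ∀ x, lam i x = c) :
    Riem.IsParallel (Riem.shapeOperator (𝓡 2) (𝓡 n) φ) := by
  choose c hc using hconst
  have hE : finrank ℝ (EuclideanSpace ℝ (Fin 2)) = 2 := by simp
  have hchar : ∀ x : M, (Riem.shapeOperator (𝓡 2) (𝓡 n) φ x).charpoly =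
      (Polynomial.X - Polynomial.C (c 0)) * (Polynomial.X - Polynomial.C (c 1)) := fun x ↦ by
    rw [(hlam x).2, Fin.prod_univ_two, hc, hc]
  -- The value comes from c₀ + c₁ = trace A_H = |τ|²/2.
  have hτ : ∀ x : M, ‖Riem.tension (𝓡 2) (𝓡 n) φ x‖ ^ 2 = 2 * (c 0 + c 1) := fun x ↦ by
    have h := Riem.trace_shapeOperator (x := x) hφ
    have h2 : finrank ℝ (TangentSpace (𝓡 2) x) = 2 := hE
    rw [Riem.trace_eq_add_of_charpoly_eq (hchar x), h2] at h
    rw [h]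
    push_cast
    ring
  exact Riem.isParallel_of_divergence_eq_zero hE (Riem.mdiffEnd_shapeOperator hφ)
    (fun _ ↦ Riem.isSymmetric_shapeOperator hφ)
    (fun y ↦ Riem.apply_apply_of_charpoly_eq (hchar y))
    (Riem.divergence_shapeOperator_eq_zero hφ (by rw [hE]; norm_num) hbi hτ)
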